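/- Let $K$ be an algebraically closed field of characteristic $0$, let $V,W$ be finite-dimensional $K$-vector spaces, and let $u\le\min(\dim V,\dim W)$ be a positive integer. Let $T=K^\times$ act on $V\oplus W$ by $\lambda(v,w)=(\lambda v,\lambda^{-1}w)$, hence on the Grassmannian $Y=\mathrm{Gr}_u(V\oplus W)$ of $u$-dimensional subspaces, and let $L=\det S^*$ be the Plücker line bundle ($S$ the tautological subbundle) with its natural $T$-linearization. For $\sigma\in\mathbb Q$, let $L(u-2\sigma)$ be the fractional linearization obtained by tensoring $L$ with the (fractional) character of weight $u-2\sigma$. A point $U\in Y$ is called $\sigma$-semistable if it is semistable for $L(u-2\sigma)$, that is, if some $T$-invariant section of a positive power of $L(u-2\sigma)$ does not vanish at $U$, and it is called $\sigma$-unstable otherwise. Let $Y_\sigma=\mathrm{Proj}\bigoplus_m H^0\bigl(L(u-2\sigma)^m\bigr)^T$ be the Mumford quotient, regarded as a variety (its closed points with the Zariski topology). The quotient $Y_{1/2}$ is identified with the projective bundle $\mathbb P\,\mathrm{Hom}(S_V,W)$ over $\mathrm{Gr}_uV$ ($S_V$ the tautological subbundle on $\mathrm{Gr}_u V$): the point $[f]$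 with $f:S\to W$ a nonzero linear map on a $u$-dimensional subspace $S\subset V$ corresponds to the class of the graph of $f$. Fix an integer $k$ with $1\le k\le u-1$. Let $\mathrm{Sec}_k(S_V,W)\subset Y_{1/2}$ be the locus of linear maps of rank $\le k$, and let $Z^-_k\subset Y_{k-1/2}$ be the locus of the classes of those $(k-\tfrac12)$-semistable points $U$ which are $\sigma$-unstable for all rational $\sigma>k$. Then: 1. $Z^-_k$ is the proper transform of $\mathrm{Sec}_k(S_V,W)$ under the birational map $Y_{1/2}\dashrightarrow Y_{k-1/2}$ induced by the identity on the points that are both $\tfrac12$-semistable and $(k-\tfrac12)$-semistable; that is, $Z^-_k$ is the closure in $Y_{k-1/2}$ of the image of the part of $\mathrm{Sec}_k(S_V,W)$ on which this map is defined. 2. $\mathrm{Sec}_k(S_V,W)$ is the variety of secant $(k-1)$-planes of the relative Segre embedding $\mathbb P S_V^*\times\mathbb P W\hookrightarrow\mathbb P(S_V^*\otimes W)=\mathbb P\,\mathrm{Hom}(S_V,W)$, that is, the closure of the union, over all $S\in\mathrm{Gr}_uV$, of the $(k-1)$-planes spanned by $k$ linearly independent points of $\mathbb P S^*\times\mathbb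 P W$. -/

import Mathlib

open Polynomial

noncomputable section

namespace CompleteCollineations

universe v w x

variable (K : Type x) (V : Type v) (W : Type w) [Field K]
  [AddCommGroup V] [Module K V] [AddCommGroup W] [Module K W] (u : ℕ)

/-! ### The Grassmannian `Gr_u (V ⊕ W)` and its homogeneous coordinate ring -/

/-- The points of the Grassmannian `Gr_u (V ⊕ W)`: the `u`-dimensional subspaces of `V ⊕ W`. -/
abbrev Gr : Type (max v w) := {U : Submodule K (V × W) // Module.finrank K U = u}

/-- The functions on `u`-tuples of vectors of `V ⊕ W`. A section of a power of the line bundle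
`det S^*` over the Grassmannian is treated as a function of a basis of the subspace `U`. -/
abbrev TupleFun : Type (max v w x) := (Fin u → V × W) → K

/-- The Plücker coordinates: the alternating `u`-linear forms on `V ⊕ W`, that is, the global
sections of the Plücker line bundle `L = det S^*`, where `S` is the tautological subbundle. -/
def pluckerForms : Submodule K (TupleFun K V W u) :=
  Submodule.span K (Set.range fun ω : (V × W) [⋀^Fin u]→ₗ[K] K => (ω : (Fin u → V × W) → K))

variable {K V W u}

/-- The action `λ (v, w) = (λ v, λ⁻¹ w)` of the torus `T = Kˣ` on `V ⊕ W`, applied to every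
member of a tuple. -/
def torusAct (c : Kˣ) (φ : Fin u → V × W) : Fin u → V × W :=
  fun i => ((c : K) • (φ i).1, ((c⁻¹ : Kˣ) : K) • (φ i).2)

variable (K V W u)

/-- The functions `F` with `F (λ φ) = λ ^ r * F φ` for all `λ` in the torus; if the rational number
`r` is not an integer, then only the zero function. -/
def weightSpace (r : ℚ) : Submodule K (TupleFun K V W u) where
  carrier := {F | F = 0 ∨ ∃ e : ℤ, (e : ℚ) = r ∧
    ∀ (c : Kˣ) (φ : Fin u → V × W), F (torusAct c φ) = ((c ^ e : Kˣ) : K) * F φ}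
  zero_mem' := Or.inl rfl
  add_mem' := by
    rintro F G (rfl | ⟨e, he, hF⟩) (rfl | ⟨e', he', hG⟩)
    · left; simp
    · right; exact ⟨e', he', by simpa using hG⟩
    · right; exact ⟨e, he, by simpa using hF⟩
    · right
      obtain rfl : e = e' := by exact_mod_cast he.trans he'.symm
      exact ⟨e, he, fun c φ => by simp [hF c φ, hG c φ, mul_add]⟩
  smul_mem' := by
    rintro a F (rfl | ⟨e, he, hF⟩)
    · left; simp
    · right
      exact ⟨e, he, fun c φ => by simp [hF c φ, mul_left_comm]⟩

/-- The invariant sections of `L(u - 2σ)^m`: the forms of degree `m` in the Plücker coordinates,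
as functions on the affine cone over the Grassmannian, on which `T` acts through the character of
weight `m (u - 2σ)`. -/
def invariantSections (σ : ℚ) (m : ℕ) : Submodule K (TupleFun K V W u) :=
  pluckerForms K V W u ^ m ⊓ weightSpace K V W u (m * (u - 2 * σ))

variable {K V W u}

lemma one_mem_invariantSections (σ : ℚ) :
    (1 : TupleFun K V W u) ∈ invariantSections K V W u σ 0 := by
  refine ⟨by rw [pow_zero]; exact Submodule.one_le.mp le_rfl, Or.inr ⟨0, by simp, fun c φ => by simp⟩⟩

lemma mul_mem_invariantSections {σ : ℚ} {m n : ℕ} {F G : TupleFun K V W u}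
    (hF : F ∈ invariantSections K V W u σ m) (hG : G ∈ invariantSections K V W u σ n) :
    F * G ∈ invariantSections K V W u σ (m + n) := by
  refine ⟨?_, ?_⟩
  · rw [pow_add]; exact Submodule.mul_mem_mul hF.1 hG.1
  · rcases hF.2 with rfl | ⟨e, he, hF'⟩
    · left; simp
    rcases hG.2 with rfl | ⟨e', he', hG'⟩
    · left; simp
    right
    refine ⟨e + e', by push_cast; rw [he, he']; ring, fun c φ => ?_⟩
    simp only [Pi.mul_apply, hF' c φ, hG' c φ, zpow_add, Units.val_mul]
    ring

/-! ### The Mumford quotients -/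

variable (K V W u)

/-- The graded ring `⨁ m, H⁰(L(u - 2σ)^m)^T`, whose elements are written as polynomials
`∑ m, F_m X^m` with `F_m` an invariant section of `L(u - 2σ)^m`. -/
def invariantRing (σ : ℚ) : Subring (TupleFun K V W u)[X] where
  carrier := {p | ∀ m, p.coeff m ∈ invariantSections K V W u σ m}
  mul_mem' := by
    intro p q hp hq n
    rw [coeff_mul]
    refine Submodule.sum_mem _ fun ij hij => ?_
    rw [← (Finset.HasAntidiagonal.mem_antidiagonal (A := ℕ)).mp hij]
    exact mul_mem_invariantSections (hp _) (hq _)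
  add_mem' := by
    intro p q hp hq n
    rw [coeff_add]
    exact Submodule.add_mem _ (hp n) (hq n)
  neg_mem' := by
    intro p hp n
    rw [coeff_neg]
    exact Submodule.neg_mem _ (hp n)
  zero_mem' := fun n => by
    rw [coeff_zero]
    exact Submodule.zero_mem _
  one_mem' := by
    intro n
    rw [coeff_one]
    split_ifs with h
    · subst h
      exact one_mem_invariantSections σ
    · exact Submodule.zero_mem _

/-- The part of degree `m` of the graded ring of invariants. -/
def grading (σ : ℚ) (m : ℕ) : AddSubgroup (invariantRing K V W u σ) where
  carrier := {p | ∀ n, n ≠ m → p.1.coeff n = 0}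
  zero_mem' := by intro n _; simp
  add_mem' := by intro p q hp hq n hn; simp [hp n hn, hq n hn]
  neg_mem' := by intro p hp n hn; simp [hp n hn]

variable {K V W u}

/-- An invariant section of `L(u - 2σ)^m`, as an element of the ring of invariants. -/
def homog (σ : ℚ) (m : ℕ) (F : TupleFun K V W u) (hF : F ∈ invariantSections K V W u σ m) :
    invariantRing K V W u σ :=
  ⟨monomial m F, fun n => by
    rw [coeff_monomial]
    split_ifs with h
    · exact h ▸ hF
    · exact Submodule.zero_mem _⟩

lemma homog_mem (σ : ℚ) (m : ℕ) (F : TupleFun K V W u)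
    (hF : F ∈ invariantSections K V W u σ m) : homog σ m F hF ∈ grading K V W u σ m := by
  intro n hn
  simp [homog, coeff_monomial, hn.symm]

lemma eq_homog {σ : ℚ} {m : ℕ} {p : invariantRing K V W u σ} (hp : p ∈ grading K V W u σ m) :
    p = homog σ m (p.1.coeff m) (p.2 m) := by
  apply Subtype.ext
  ext1 n
  simp only [homog, coeff_monomial]
  split_ifs with h
  · rw [h]
  · exact hp n (Ne.symm h)

instance gradedMonoid (σ : ℚ) : SetLike.GradedMonoid (grading K V W u σ) where
  one_mem := by
    intro n hn
    simp [coeff_one, hn]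
  mul_mem := by
    intro i j p q hp hq
    rw [eq_homog hp, eq_homog hq]
    intro n hn
    simp [homog, monomial_mul_monomial, coeff_monomial, hn.symm]

lemma coeff_coeAddMonoidHom (σ : ℚ) (x : DirectSum ℕ fun m => grading K V W u σ m) (n : ℕ) :
    (DirectSum.coeAddMonoidHom (grading K V W u σ) x).1.coeff n = (x n).1.1.coeff n := by
  classical
  induction x using DirectSum.induction_on with
  | zero => simp
  | of i p =>
    rw [DirectSum.coeAddMonoidHom_of]
    by_cases h : i = n
    · subst h; rw [DirectSum.of_eq_same]
    · rw [DirectSum.of_eq_of_ne _ _ _ (Ne.symm h), p.2 n (Ne.symm h)]; simp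
  | add x y hx hy => simp [hx, hy]

lemma isInternal_grading (σ : ℚ) : DirectSum.IsInternal (grading K V W u σ) := by
  classical
  refine ⟨(injective_iff_map_eq_zero _).mpr fun x hx => ?_, fun p => ?_⟩
  · ext n j : 4
    by_cases h : j = n
    · subst h
      rw [← coeff_coeAddMonoidHom, hx]; simp
    · rw [(x n).2 j h]; simp
  · refine ⟨∑ m ∈ p.1.support, DirectSum.of (fun m => grading K V W u σ m) m
      ⟨_, homog_mem σ m (p.1.coeff m) (p.2 m)⟩, ?_⟩
    rw [map_sum]
    simp only [DirectSum.coeAddMonoidHom_of]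
    apply Subtype.ext
    rw [AddSubmonoidClass.coe_finsetSum]
    exact p.1.as_sum_support.symm

instance gradedRing (σ : ℚ) : GradedRing (grading K V W u σ) where
  toDecomposition := (isInternal_grading σ).chooseDecomposition

lemma coeff_decompose (σ : ℚ) (p : invariantRing K V W u σ) (m n : ℕ) :
    (DirectSum.decompose (grading K V W u σ) p m).1.1.coeff n
      = if n = m then p.1.coeff n else 0 := by
  split_ifs with h
  · subst h
    rw [← coeff_coeAddMonoidHom]
    congr 2
    exact (DirectSum.decompose (grading K V W u σ)).symm_apply_apply p
  · exact (DirectSum.decompose (grading K V W u σ) p m).2 n h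

variable (K V W u)

/-- The Mumford quotient `Y_σ = Proj ⨁ m, H⁰(L(u - 2σ)^m)^T`. -/
def mumfordQuotient (σ : ℚ) : AlgebraicGeometry.Scheme :=
  AlgebraicGeometry.Proj (grading K V W u σ)

/-- The points of the Mumford quotient `Y_σ` as a variety: the closed points of the scheme, with
the Zariski topology. -/
abbrev Y (σ : ℚ) : Type _ := closedPoints (mumfordQuotient K V W u σ)

variable {K V W u}
variable [FiniteDimensional K V] [FiniteDimensional K W]

/-- A basis of the subspace `U`. A form of degree `m` in the Plücker coordinates is multiplied by
the `m`-th power of a determinant if another basis is used. -/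
def frame (U : Gr K V W u) : Fin u → V × W :=
  fun i => (Module.finBasisOfFinrankEq K U.1 U.2 i : V × W)

/-- `U` is `σ`-semistable: it is semistable for the linearization `L(u - 2σ)`, that is, some
invariant section of a positive power of `L(u - 2σ)` does not vanish at `U`. -/
def IsSemistable (σ : ℚ) (U : Gr K V W u) : Prop :=
  ∃ m : ℕ, 0 < m ∧ ∃ F ∈ invariantSections K V W u σ m, F (frame U) ≠ 0

/-- Evaluation of invariant sections at `U`. -/
def evalAt (σ : ℚ) (U : Gr K V W u) : invariantRing K V W u σ →+* K[X] :=
  (mapRingHom (Pi.evalRingHom (fun _ : Fin u → V × W => K) (frame U))).comp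
    (invariantRing K V W u σ).subtype

lemma coeff_evalAt (σ : ℚ) (U : Gr K V W u) (p : invariantRing K V W u σ) (m : ℕ) :
    (evalAt σ U p).coeff m = p.1.coeff m (frame U) := by
  simp [evalAt]

/-- The image in `Y_σ`, as a scheme, of a `σ`-semistable point `U`: the homogeneous prime ideal
generated by the invariant sections that vanish at `U`. -/
def schemePoint (σ : ℚ) (U : Gr K V W u) (hU : IsSemistable σ U) :
    ProjectiveSpectrum (grading K V W u σ) where
  asHomogeneousIdeal := ⟨RingHom.ker (evalAt σ U), by
    intro m p hp
    rw [RingHom.mem_ker] at hp ⊢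
    ext n
    rw [coeff_evalAt, coeff_decompose]
    split_ifs
    · rw [← coeff_evalAt, hp]
    · simp⟩
  isPrime := RingHom.ker_isPrime _
  not_irrelevant_le := by
    obtain ⟨m, hm, F, hF, hne⟩ := hU
    intro hle
    have h1 : homog σ m F hF ∈ HomogeneousIdeal.irrelevant (grading K V W u σ) := by
      rw [HomogeneousIdeal.mem_irrelevant_iff, GradedRing.proj_apply,
        DirectSum.decompose_of_mem_ne _ (homog_mem σ m F hF) hm.ne']
    have h2 : evalAt σ U (homog σ m F hF) = 0 := hle h1
    apply hne
    have := coeff_evalAt σ U (homog σ m F hF) m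
    rw [h2] at this
    simpa [homog] using this.symm

lemma evalAt_homog {σ : ℚ} (U : Gr K V W u) {m : ℕ} {F : TupleFun K V W u}
    (hF : F ∈ invariantSections K V W u σ m) :
    evalAt σ U (homog σ m F hF) = monomial m (F (frame U)) := by
  ext n
  rw [coeff_evalAt, coeff_monomial]
  by_cases hn : m = n <;> simp [homog, coeff_monomial, hn]

lemma mem_schemePoint {σ : ℚ} {U : Gr K V W u} (hU : IsSemistable σ U)
    (p : invariantRing K V W u σ) :
    p ∈ (schemePoint σ U hU).asHomogeneousIdeal.toIdeal ↔ evalAt σ U p = 0 := Iff.rfl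

lemma isClosed_schemePoint (σ : ℚ) (U : Gr K V W u) (hU : IsSemistable σ U) :
    IsClosed ({schemePoint σ U hU} : Set (ProjectiveSpectrum (grading K V W u σ))) := by
  classical
  rw [← closure_subset_iff_isClosed]
  intro q hq
  have hle := (ProjectiveSpectrum.le_iff_mem_closure _ _ _).mpr hq
  rw [Set.mem_singleton_iff]
  refine le_antisymm ?_ hle
  rw [← ProjectiveSpectrum.as_ideal_le_as_ideal] at hle ⊢
  have hle' : ∀ r : invariantRing K V W u σ, evalAt σ U r = 0 →
      r ∈ q.asHomogeneousIdeal.toIdeal := fun r hr => hle ((mem_schemePoint hU r).mpr hr)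
  intro a ha
  by_contra hna
  have hna' : evalAt σ U a ≠ 0 := fun h => hna ((mem_schemePoint hU a).mpr h)
  obtain ⟨m, hm⟩ : ∃ m, a.1.coeff m (frame U) ≠ 0 := by
    by_contra! h
    exact hna' (by ext m; rw [coeff_evalAt, h m, coeff_zero])
  -- the constants
  have hκ : ∀ c : K, c • (1 : TupleFun K V W u) ∈ invariantSections K V W u σ 0 :=
    fun c => Submodule.smul_mem _ _ (one_mem_invariantSections σ)
  set κ : K → invariantRing K V W u σ := fun c => homog σ 0 _ (hκ c) with hκdef
  have hκe : ∀ c, evalAt σ U (κ c) = C c := fun c => by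
    rw [hκdef, evalAt_homog, monomial_zero_left]; simp
  have hκu : ∀ c : K, c ≠ 0 → κ c⁻¹ * κ c = 1 := fun c hc => by
    apply Subtype.ext
    change monomial 0 (c⁻¹ • (1 : TupleFun K V W u)) * monomial 0 (c • 1) = 1
    rw [monomial_mul_monomial, smul_mul_smul_comm, inv_mul_cancel₀ hc]
    simp
  set f := homog σ m _ (a.2 m) with hf
  have hfq : f ∈ q.asHomogeneousIdeal.toIdeal := by
    have h := q.asHomogeneousIdeal.isHomogeneous m ha
    convert h using 1
    apply Subtype.ext
    ext1 n
    rw [coeff_decompose]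
    simp only [hf, homog, coeff_monomial, eq_comm (a := m)]
    split_ifs with h
    · rw [h]
    · rfl
  set c := a.1.coeff m (frame U) with hc
  rcases Nat.eq_zero_or_pos m with h0 | hpos
  · have h1 : f - κ c ∈ q.asHomogeneousIdeal.toIdeal := hle' _ (by
      rw [map_sub, hκe, hf, evalAt_homog, h0, monomial_zero_left, hc, h0, sub_self])
    have h2 : κ c ∈ q.asHomogeneousIdeal.toIdeal := by
      simpa using Ideal.sub_mem _ hfq h1
    have h3 := Ideal.mul_mem_left _ (κ c⁻¹) h2
    rw [hκu c hm] at h3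
    exact q.isPrime.ne_top ((Ideal.eq_top_iff_one _).mpr h3)
  · apply q.not_irrelevant_le
    intro b hb
    have key : ∀ n, ((DirectSum.decompose (grading K V W u σ) b n : grading K V W u σ n) :
        invariantRing K V W u σ) ∈ q.asHomogeneousIdeal.toIdeal := by
      intro n
      rcases Nat.eq_zero_or_pos n with rfl | hn
      · have h := (HomogeneousIdeal.mem_irrelevant_iff _ b).mp hb
        rw [GradedRing.proj_apply] at h
        rw [h]
        exact Ideal.zero_mem _
      · rw [eq_homog (DirectSum.decompose (grading K V W u σ) b n).2]
        set G := (DirectSum.decompose (grading K V W u σ) b n).1.1.coeff n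
        have hG : G ∈ invariantSections K V W u σ n :=
          (DirectSum.decompose (grading K V W u σ) b n).1.2 n
        set g := homog σ n G hG with hg
        have h1 : κ (c ^ n) * g ^ m - κ (G (frame U) ^ m) * f ^ n
            ∈ q.asHomogeneousIdeal.toIdeal := hle' _ (by
          rw [map_sub, map_mul, map_mul, map_pow, map_pow, hκe, hκe, hf, hg, evalAt_homog,
            evalAt_homog, monomial_pow, monomial_pow, C_mul_monomial, C_mul_monomial,
            mul_comm n m, mul_comm (c ^ n), sub_self])
        have h2 : κ (c ^ n) * g ^ m ∈ q.asHomogeneousIdeal.toIdeal := by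
          have h3 : κ (G (frame U) ^ m) * f ^ n ∈ q.asHomogeneousIdeal.toIdeal :=
            Ideal.mul_mem_left _ _ (Ideal.pow_mem_of_mem _ hfq n hn)
          simpa using Ideal.add_mem _ h1 h3
        have h4 := Ideal.mul_mem_left _ (κ (c ^ n)⁻¹) h2
        rw [← mul_assoc, hκu _ (pow_ne_zero n hm), one_mul] at h4
        exact q.isPrime.mem_of_pow_mem m h4
    rw [← DirectSum.sum_support_decompose (grading K V W u σ) b]
    exact Ideal.sum_mem _ fun n _ => key n

/-- The quotient map from the `σ`-semistable points to the Mumford quotient `Y_σ`. -/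
def toQuotient (σ : ℚ) (U : Gr K V W u) (hU : IsSemistable σ U) : Y K V W u σ :=
  ⟨schemePoint σ U hU, isClosed_schemePoint σ U hU⟩

/-! ### The blow-up locus and proper transforms -/

variable (K V W u)

/-- The locus `Z⁻_k` in `Y⁻_k = Y_{k - 1/2}` that consists of the points unstable for all
`σ > k`. -/
def Zminus (k : ℕ) : Set (Y K V W u (k - 1 / 2)) :=
  {y | ∃ (U : Gr K V W u) (hU : IsSemistable (k - 1 / 2 : ℚ) U),
    (∀ σ : ℚ, (k : ℚ) < σ → ¬ IsSemistable σ U) ∧ toQuotient _ U hU = y}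

variable {K V W u}

/-- The proper transform in `Y_τ` of a subset `A` of `Y_σ` under the birational map from `Y_σ` to
`Y_τ` induced by the identity on the points that are semistable both for `σ` and for `τ`: the
closure of the image of the part of `A` where this map is defined. -/
def properTransform (σ τ : ℚ) (A : Set (Y K V W u σ)) : Set (Y K V W u τ) :=
  closure {y | ∃ (U : Gr K V W u) (hσ : IsSemistable σ U) (hτ : IsSemistable τ U),
    toQuotient σ U hσ ∈ A ∧ toQuotient τ U hτ = y}

/-! ### The projective bundle `Y_{1/2} = ℙ Hom (S_V, W)` over `Gr_u V` -/

/-- The graph in `V ⊕ W` of a linear map `f : S → W` from a subspace `S` of `V`. -/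
def graph (S : Submodule K V) (f : S →ₗ[K] W) : Submodule K (V × W) :=
  LinearMap.range (S.subtype.prod f)

/-- The point `y` of `Y_{1/2}` is the point `[f]` of the projective bundle `ℙ Hom (S_V, W)` over
`Gr_u V`, where `S` is a `u`-dimensional subspace of `V` and `f : S → W` is a nonzero linear map:
`y` is the class of the graph of `f`. -/
def IsClassOf (y : Y K V W u (1 / 2)) (S : Submodule K V) (f : S →ₗ[K] W) : Prop :=
  Module.finrank K S = u ∧ f ≠ 0 ∧
    ∃ (U : Gr K V W u) (hU : IsSemistable (1 / 2 : ℚ) U),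
      U.1 = graph S f ∧ toQuotient (1 / 2) U hU = y

variable (K V W u)

/-- The locus `Sec_k (S_V, W)` in `Y_{1/2} = ℙ Hom (S_V, W)` of linear maps of rank at most `k`. -/
def Sec (k : ℕ) : Set (Y K V W u (1 / 2)) :=
  {y | ∃ (S : Submodule K V) (f : S →ₗ[K] W), IsClassOf y S f ∧
    Module.finrank K (LinearMap.range f) ≤ k}

/-- The variety of secant `(k - 1)`-planes of the relative Segre embedding
`ℙ S_V^* × ℙ W → ℙ (S_V^* ⊗ W) = ℙ Hom (S_V, W)`: the closure of the union, over all `S` in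
`Gr_u V`, of the linear spans of `k` linearly independent points `[ξ i ⊗ w i]` of the Segre variety
`ℙ S^* × ℙ W`. -/
def secantVariety (k : ℕ) : Set (Y K V W u (1 / 2)) :=
  closure {y | ∃ (S : Submodule K V) (f : S →ₗ[K] W), IsClassOf y S f ∧
    ∃ (ξ : Fin k → Module.Dual K S) (w : Fin k → W),
      LinearIndependent K (fun i => (ξ i).smulRight (w i)) ∧
      f ∈ Submodule.span K (Set.range fun i => (ξ i).smulRight (w i))}

end CompleteCollineations

end

/-!
Everything is expressed in the Plücker coordinates `p_I` for a basis of `V ⊕ W` adapted to the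
decomposition. If `j = wDeg I` of the coordinates in `I` belong to `W`, then the torus acts on `p_I`
with weight `u - 2 j`. Hence a subspace `U` is semistable for `σ` exactly if `σ` lies between the
smallest and the largest `j` for which some `p_I` with `wDeg I = j` does not vanish at `U`. The
smallest such `j` is `0` if and only if `U` projects injectively to `V`, that is, `U` is a graph,
and the largest one is the rank of the projection of `U` to `W` (`forall_plucker_eq_zero_iff`).
Therefore both `Z⁻_k ⊆ Y_{k - 1/2}` and `Sec_k ⊆ Y_{1/2}` are the locus `rankLocus` of the classes
of the subspaces whose projection to `W` has rank at most `k` (`Zminus_eq_rankLocus`,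
`Sec_eq_rankLocus`).

For `σ = n - 1/2` with `n ≤ k` this locus is closed (`isClosed_rankLocus`): if `wDeg I < n` and
`k < wDeg J`, a suitable monomial in `p_I` and `p_J` is an invariant section, and such sections cut
out the locus. This argument needs that every closed point of the Mumford quotient is the class of
a semistable subspace (`exists_toQuotient_eq`). The proof lifts the prime ideal of the point to the
polynomial ring in the Plücker coordinates and adds the ideal of the Grassmannian. The projection
of polynomials to torus weight zero plays the role of the Reynolds operator and shows that the
lifted ideal contracts to the prime ideal (`mem_of_mem_liftIdeal`). The Nullstellensatz then yields
a zero of the lifted ideal away from the origin, and the Plücker relations, read as Cramer's rule,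
show that it consists of the coordinates of a subspace (`exists_coords_of_relation`).

It remains to see that general points of `Z⁻_k` come from `Sec_k`. A displacement of a basis of `U`
in a general direction in `V` does not change the projection to `W` and makes the projection to `V`
injective (`rankLocus_subset_properTransform`), and sections are polynomial along the displacement.
Finally, a nonzero map of rank at most `k` is in fact a combination of `k` linearly independent maps
of rank one (`exists_mem_span_smulRight`), so `Sec_k`, being closed, is the secant variety.
-/

noncomputable section

namespace CompleteCollineations

/-! ### Plücker coordinates -/

section Plucker

variable (K : Type*) (V : Type*) (W : Type*) [Field K]
  [AddCommGroup V] [Module K V] [FiniteDimensional K V]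
  [AddCommGroup W] [Module K W] [FiniteDimensional K W]

/-- The index set of a basis of `V ⊕ W`: the left summand indexes a basis of `V`, the right one a
basis of `W`. -/
abbrev Idx : Type := Fin (Module.finrank K V) ⊕ Fin (Module.finrank K W)

/-- A basis of `V ⊕ W` that consists of a basis of `V` and a basis of `W`. -/
def coordBasis : Module.Basis (Idx K V W) K (V × W) :=
  (Module.finBasis K V).prod (Module.finBasis K W)

variable {K V W} {u : ℕ}

/-- The Plücker coordinate of a tuple `φ` with index `I`, the minor of the coordinate matrix of `φ`
that is given by the coordinates `I 0, …, I (u - 1)`. All sequences `I` are allowed, not only the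
increasing ones, so that Plücker relations take a uniform shape. -/
def plucker (I : Fin u → Idx K V W) : (V × W) [⋀^Fin u]→ₗ[K] K :=
  Matrix.detRowAlternating.compLinearMap (LinearMap.pi fun i => (coordBasis K V W).coord (I i))

lemma plucker_apply (I : Fin u → Idx K V W) (φ : Fin u → V × W) :
    plucker I φ = (Matrix.of fun j i => (coordBasis K V W).coord (I i) (φ j)).det := rfl

/-- The number of coordinates of `W` among the coordinates with index `I`. -/
def wDeg (I : Fin u → Idx K V W) : ℕ := (Finset.univ.filter fun i => (I i).isRight).card

/-- The weight of the Plücker coordinate with index `I` under the torus. -/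
def tWeight (I : Fin u → Idx K V W) : ℤ := u - 2 * wDeg I

lemma plucker_torusAct (c : Kˣ) (I : Fin u → Idx K V W) (φ : Fin u → V × W) :
    plucker I (torusAct c φ) = ((c ^ tWeight I : Kˣ) : K) * plucker I φ := by
  have hcoord : ∀ a (x : V × W), (coordBasis K V W).coord a ((c : K) • x.1, ((c⁻¹ : Kˣ) : K) • x.2)
      = ((if a.isRight then c⁻¹ else c : Kˣ) : K) * (coordBasis K V W).coord a x := by
    rintro (a | a) x <;> simp [coordBasis]
  simp only [plucker_apply, torusAct, hcoord]
  have h := Matrix.det_mul_row (fun i => ((if (I i).isRight then c⁻¹ else c : Kˣ) : K))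
    (Matrix.of fun j i => (coordBasis K V W).coord (I i) (φ j))
  simp only [Matrix.of_apply] at h
  rw [h]
  congr 1
  rw [← Units.coe_prod]
  congr 1
  rw [Finset.prod_ite, Finset.prod_const, Finset.prod_const, inv_pow, ← zpow_natCast,
    ← zpow_natCast, ← zpow_neg, ← zpow_add]
  congr 1
  have h2 := Finset.card_filter_add_card_filter_not (s := (Finset.univ : Finset (Fin u)))
    (fun i => ((I i).isRight : Prop))
  rw [Finset.card_univ, Fintype.card_fin] at h2
  unfold tWeight wDeg
  omega

/-- Expansion of an alternating form in Plücker coordinates. Each coordinate is counted once for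
every ordering of its index, hence the factor `u!`. -/
lemma factorial_smul_alternating (ω : (V × W) [⋀^Fin u]→ₗ[K] K) (φ : Fin u → V × W) :
    (u.factorial : K) * ω φ
      = ∑ I : Fin u → Idx K V W, ω (fun i => coordBasis K V W (I i)) * plucker I φ := by
  classical
  set b := coordBasis K V W with hb
  have hexp : ∀ ψ : Fin u → V × W,
      ω ψ = ∑ I : Fin u → Idx K V W, (∏ i, b.coord (I i) (ψ i)) * ω (fun i => b (I i)) := by
    intro ψ
    have h1 : ψ = fun i => ∑ a, b.coord a (ψ i) • b a := by
      funext i; exact (b.sum_repr (ψ i)).symm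
    conv_lhs => rw [h1]
    have := ω.toMultilinearMap.map_sum (fun i a => b.coord a (ψ i) • b a)
    rw [AlternatingMap.coe_multilinearMap] at this
    rw [this]
    refine Finset.sum_congr rfl fun I _ => ?_
    have h2 := ω.toMultilinearMap.map_smul_univ (fun i => b.coord (I i) (ψ i)) (fun i => b (I i))
    rw [AlternatingMap.coe_multilinearMap] at h2
    rw [h2, smul_eq_mul]
  have hperm : ∀ π : Equiv.Perm (Fin u),
      ω φ = ∑ I : Fin u → Idx K V W,
        ω (fun i => b (I i)) * ((Equiv.Perm.sign π : ℤ) * ∏ i, b.coord (I i) (φ (π i))) := by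
    intro π
    have h1 := ω.map_perm φ π
    have h2 := hexp (φ ∘ π)
    have hs : ((Equiv.Perm.sign π : ℤ) : K) * ((Equiv.Perm.sign π : ℤ) : K) = 1 := by
      rcases Int.units_eq_one_or (Equiv.Perm.sign π) with h | h <;> simp [h]
    have h3 : ω φ = ((Equiv.Perm.sign π : ℤ) : K) * ω (φ ∘ π) := by
      have : ω (φ ∘ π) = ((Equiv.Perm.sign π : ℤ) : K) * ω φ := by
        rw [h1, Units.smul_def, zsmul_eq_mul]
      rw [this, ← mul_assoc, hs, one_mul]
    rw [h3, h2, Finset.mul_sum]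
    refine Finset.sum_congr rfl fun I _ => ?_
    simp only [Function.comp_apply]
    ring
  have hcard : (u.factorial : K) * ω φ = ∑ _π : Equiv.Perm (Fin u), ω φ := by
    rw [Finset.sum_const, Finset.card_univ, Fintype.card_perm, Fintype.card_fin, nsmul_eq_mul]
  rw [hcard, Finset.sum_congr rfl fun π _ => hperm π, Finset.sum_comm]
  refine Finset.sum_congr rfl fun I _ => ?_
  rw [← Finset.mul_sum, plucker_apply, Matrix.det_apply']
  rfl

lemma plucker_mem_pluckerForms (I : Fin u → Idx K V W) :
    (plucker I : (Fin u → V × W) → K) ∈ pluckerForms K V W u :=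
  Submodule.subset_span ⟨plucker I, rfl⟩

lemma pluckerForms_eq_span [CharZero K] : pluckerForms K V W u =
    Submodule.span K (Set.range fun I : Fin u → Idx K V W => (plucker I : TupleFun K V W u)) := by
  refine le_antisymm (Submodule.span_le.mpr ?_) (Submodule.span_le.mpr ?_)
  · rintro _ ⟨ω, rfl⟩
    have hu : (u.factorial : K) ≠ 0 := by exact_mod_cast u.factorial_ne_zero
    have : (ω : (Fin u → V × W) → K) = (u.factorial : K)⁻¹ • ∑ I : Fin u → Idx K V W,
        ω (fun i => coordBasis K V W (I i)) • (plucker I : (Fin u → V × W) → K) := by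
      funext φ
      rw [Pi.smul_apply, Finset.sum_apply, smul_eq_mul, eq_inv_mul_iff_mul_eq₀ hu,
        factorial_smul_alternating]
      rfl
    simp only [SetLike.mem_coe]
    rw [this]
    exact Submodule.smul_mem _ _ (Submodule.sum_mem _ fun I _ =>
      Submodule.smul_mem _ _ (Submodule.subset_span ⟨I, rfl⟩))
  · rintro _ ⟨I, rfl⟩
    exact plucker_mem_pluckerForms I

/-- The homogeneous coordinate ring of the Grassmannian is presented by the polynomial ring in the
Plücker coordinates. -/
lemma pluckerForms_pow_eq_map [CharZero K] (m : ℕ) : pluckerForms K V W u ^ m =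
    (MvPolynomial.homogeneousSubmodule (Fin u → Idx K V W) K m).map
      (MvPolynomial.aeval fun I => (plucker I : TupleFun K V W u)).toLinearMap := by
  have h1 : pluckerForms K V W u = (MvPolynomial.homogeneousSubmodule (Fin u → Idx K V W) K 1).map
      (MvPolynomial.aeval fun I => (plucker I : TupleFun K V W u)).toLinearMap := by
    rw [MvPolynomial.homogeneousSubmodule_one_eq_span_X, Submodule.map_span, pluckerForms_eq_span,
      ← Set.range_comp]
    congr 2
    funext I
    simp
  rw [h1, ← Submodule.map_pow, MvPolynomial.homogeneousSubmodule_one_pow]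

/-- The Plücker coordinates of a tuple, as a point of affine space. -/
def coords (φ : Fin u → V × W) : (Fin u → Idx K V W) → K := fun I => plucker I φ

lemma aeval_plucker_apply (P : MvPolynomial (Fin u → Idx K V W) K) (φ : Fin u → V × W) :
    MvPolynomial.aeval (fun I => (plucker I : TupleFun K V W u)) P φ
      = MvPolynomial.eval (coords φ) P := by
  induction P using MvPolynomial.induction_on with
  | C a => simp
  | add p q hp hq => simp [hp, hq]
  | mul_X p i hp => simp [hp, coords]

/-- The Plücker relations, in the form of Cramer's rule: up to the power `u - 1` of a minor, every
minor is a determinant in the minors that differ from the given one in a single index. -/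
lemma plucker_relation (I₀ I : Fin u → Idx K V W) (φ : Fin u → V × W) :
    plucker I₀ φ ^ (u - 1) * plucker I φ
      = (Matrix.of fun i j => plucker (Function.update I₀ i (I j)) φ).det := by
  classical
  set A := Matrix.of fun j i => (coordBasis K V W).coord (I₀ i) (φ j) with hA
  set B := Matrix.of fun j i => (coordBasis K V W).coord (I i) (φ j) with hB
  have h : (Matrix.of fun i j => plucker (Function.update I₀ i (I j)) φ) = A.adjugate * B := by
    ext i j
    have h1 : (A.adjugate * B) i j = (A.adjugate.mulVec fun l => B l j) i := rfl
    rw [h1, ← Matrix.cramer_eq_adjugate_mulVec, Matrix.cramer_apply, Matrix.of_apply, plucker_apply]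
    congr 1
    ext l m
    by_cases hm : m = i
    · subst hm; simp [hB]
    · simp [hA, hm]
  rw [h, Matrix.det_mul, Matrix.det_adjugate, Fintype.card_fin]
  rfl

/-- A point of affine space that satisfies the Plücker relations for a coordinate that does not
vanish there is a multiple of the Plücker coordinates of a tuple of vectors. -/
lemma exists_coords_of_relation (x : (Fin u → Idx K V W) → K) (I₀ : Fin u → Idx K V W)
    (h₀ : x I₀ ≠ 0) (hu : 0 < u)
    (hx : ∀ I, x I₀ ^ (u - 1) * x I
      = (Matrix.of fun i j => x (Function.update I₀ i (I j))).det) :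
    ∃ φ : Fin u → V × W, x = x I₀ • coords φ := by
  classical
  set b := coordBasis K V W with hb
  refine ⟨fun i => b.equivFun.symm fun a => (x I₀)⁻¹ * x (Function.update I₀ i a), ?_⟩
  funext I
  have h1 : ∀ i a, b.coord a (b.equivFun.symm fun a => (x I₀)⁻¹ * x (Function.update I₀ i a))
      = (x I₀)⁻¹ * x (Function.update I₀ i a) := by
    intro i a
    rw [Module.Basis.coord_apply, ← Module.Basis.equivFun_apply, LinearEquiv.apply_symm_apply]
  simp only [Pi.smul_apply, coords, plucker_apply, smul_eq_mul, ← hb, h1]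
  have h2 : (Matrix.of fun j i => (x I₀)⁻¹ * x (Function.update I₀ j (I i)))
      = (x I₀)⁻¹ • (Matrix.of fun i j => x (Function.update I₀ i (I j))) := by
    ext; simp
  rw [h2, Matrix.det_smul, ← hx, Fintype.card_fin]
  obtain ⟨n, rfl⟩ : ∃ n, u = n + 1 := ⟨u - 1, by omega⟩
  rw [Nat.add_sub_cancel, inv_pow]
  field_simp
  ring

end Plucker

/-! ### Weights of the torus -/

section Weights

lemma eval_monomial_torus {K : Type*} [Field K] {τ : Type*} (w : τ → ℤ) (c : Kˣ) (x : τ → K)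
    (d : τ →₀ ℕ) (a : K) :
    MvPolynomial.eval (fun I => ((c ^ w I : Kˣ) : K) * x I) (MvPolynomial.monomial d a)
      = MvPolynomial.eval x (MvPolynomial.monomial d a) * ((c ^ Finsupp.weight w d : Kˣ) : K) := by
  simp only [MvPolynomial.eval_monomial, Finsupp.prod, mul_pow, Finset.prod_mul_distrib]
  have : ∏ i ∈ d.support, ((c ^ w i : Kˣ) : K) ^ d i = ((c ^ Finsupp.weight w d : Kˣ) : K) := by
    have hz : ∀ t : Finset τ, c ^ (∑ i ∈ t, d i • w i) = ∏ i ∈ t, c ^ (d i • w i) := by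
      classical
      intro t
      induction t using Finset.induction_on with
      | empty => simp
      | insert i t hi ih => rw [Finset.sum_insert hi, Finset.prod_insert hi, zpow_add, ih]
    rw [Finsupp.weight_apply, Finsupp.sum, hz, Units.coe_prod]
    refine Finset.prod_congr rfl fun i _ => ?_
    rw [← Units.val_pow_eq_pow_val, ← zpow_natCast, ← zpow_mul, nsmul_eq_mul, mul_comm]
  rw [this]
  ring

lemma eval_smul_of_isHomogeneous {K : Type*} [Field K] {τ : Type*} {P : MvPolynomial τ K} {m : ℕ}
    (hP : P.IsHomogeneous m) (s : K) (x : τ → K) :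
    MvPolynomial.eval (s • x) P = s ^ m * MvPolynomial.eval x P := by
  rw [MvPolynomial.eval_eq, MvPolynomial.eval_eq, Finset.mul_sum]
  refine Finset.sum_congr rfl fun d hd => ?_
  have hdeg : ∑ i ∈ d.support, d i = m := by
    rw [← hP (MvPolynomial.mem_support_iff.mp hd), Finsupp.weight_apply, Finsupp.sum]
    simp
  simp only [Pi.smul_apply, smul_eq_mul, mul_pow, Finset.prod_mul_distrib]
  rw [Finset.prod_pow_eq_pow_sum, hdeg]
  ring

variable {K : Type*} [Field K] [CharZero K]

/-- The characters `c ↦ c ^ n` of the multiplicative group are linearly independent, so that a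
weight decomposition of a function is unique. -/
lemma sum_filter_weight_eq {α : Type*} (s : Finset α) (a : α → K) (g : α → ℤ) (A : K) (e : ℤ)
    (h : ∀ c : Kˣ, ∑ d ∈ s, a d * ((c ^ g d : Kˣ) : K) = A * ((c ^ e : Kˣ) : K)) (n : ℤ) :
    ∑ d ∈ s with g d = n, a d = if n = e then A else 0 := by
  classical
  have hinj : Function.Injective fun n : ℤ => (Units.coeHom K).comp (zpowGroupHom n) := by
    intro n m hnm
    have h2 := DFunLike.congr_fun hnm (Units.mk0 (2 : K) two_ne_zero)
    simp only [MonoidHom.comp_apply, zpowGroupHom_apply, Units.coeHom_apply,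
      Units.val_zpow_eq_zpow_val, Units.val_mk0] at h2
    have h3 : ((2 : ℚ) ^ n) = 2 ^ m := by
      have : (((2 : ℚ) ^ n : ℚ) : K) = (((2 : ℚ) ^ m : ℚ) : K) := by push_cast; exact h2
      exact_mod_cast this
    exact zpow_right_injective₀ (by norm_num) (by norm_num) h3
  have hli := (linearIndependent_monoidHom Kˣ K).comp _ hinj
  rw [linearIndependent_iff'] at hli
  set T : Finset ℤ := insert n (insert e (s.image g)) with hT
  have key := hli T (fun m => (∑ d ∈ s with g d = m, a d) - if m = e then A else 0) (by
    funext c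
    simp only [Finset.sum_apply, Pi.smul_apply, Function.comp_apply, MonoidHom.comp_apply,
      zpowGroupHom_apply, Units.coeHom_apply, smul_eq_mul, Pi.zero_apply, sub_mul,
      Finset.sum_sub_distrib]
    rw [sub_eq_zero]
    have h1 : ∑ m ∈ T, (if m = e then A else 0) * ((c ^ m : Kˣ) : K) = A * ((c ^ e : Kˣ) : K) := by
      rw [Finset.sum_eq_single e]
      · simp
      · intro b _ hb; simp [hb]
      · intro he; exact absurd (by simp [hT]) he
    rw [h1, ← h c, ← Finset.sum_fiberwise_of_maps_to (s := s) (t := T) (g := g)]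
    · refine Finset.sum_congr rfl fun m _ => ?_
      rw [Finset.sum_mul]
      refine Finset.sum_congr rfl fun d hd => ?_
      rw [(Finset.mem_filter.mp hd).2]
    · intro d hd
      simp only [hT, Finset.mem_insert, Finset.mem_image]
      exact Or.inr (Or.inr ⟨d, hd, rfl⟩)) n (by simp [hT])
  exact sub_eq_zero.mp key

/-- The values of the weighted homogeneous components of a polynomial, from its values along an
orbit on which it is an eigenfunction. -/
lemma eval_weightedHomogeneousComponent {τ : Type*} (w : τ → ℤ) (x : τ → K)
    (P : MvPolynomial τ K) (A : K) (e : ℤ)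
    (h : ∀ c : Kˣ, MvPolynomial.eval (fun I => ((c ^ w I : Kˣ) : K) * x I) P
      = A * ((c ^ e : Kˣ) : K)) (n : ℤ) :
    MvPolynomial.eval x (MvPolynomial.weightedHomogeneousComponent w n P)
      = if n = e then A else 0 := by
  classical
  rw [MvPolynomial.weightedHomogeneousComponent_apply, map_sum]
  refine sum_filter_weight_eq P.support _ (Finsupp.weight w) A e (fun c => ?_) n
  rw [← h c]
  conv_rhs => rw [P.as_sum, map_sum]
  exact Finset.sum_congr rfl fun d _ => (eval_monomial_torus w c x d _).symm

end Weights

/-! ### Invariant sections as polynomials in the Plücker coordinates -/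

section Cone

variable {K : Type*} {V : Type*} {W : Type*} [Field K] {u : ℕ}

/-- Evaluation at the multiple by `s` of the point of the affine cone that is given by `φ`. -/
def evalCone (s : K) (φ : Fin u → V × W) :
    ((Fin u → V × W) → K)[X] →+* K :=
  (evalRingHom s).comp (mapRingHom (Pi.evalRingHom (fun _ : Fin u → V × W => K) φ))

lemma evalCone_monomial (s : K) (φ : Fin u → V × W) (m : ℕ) (F : TupleFun K V W u) :
    evalCone s φ (monomial m F) = s ^ m * F φ := by
  simp [evalCone, mul_comm]

/-- As `K` is infinite, the values on the multiples of a point of the cone determine the parts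
of all degrees in `X`. -/
lemma eq_of_evalCone_eq [CharZero K] {p q : (TupleFun K V W u)[X]}
    (h : ∀ s φ, evalCone s φ p = evalCone s φ q) : p = q := by
  ext m φ
  have : p.map (Pi.evalRingHom (fun _ : Fin u → V × W => K) φ)
      = q.map (Pi.evalRingHom (fun _ : Fin u → V × W => K) φ) :=
    Polynomial.funext fun s => h s φ
  simpa using congrArg (fun r => coeff r m) this

variable [AddCommGroup V] [Module K V] [AddCommGroup W] [Module K W]

/-- The weights of the Plücker coordinates after the linearization is shifted by the character of
weight `r`. -/
def shiftedWeight (r : ℤ) (I : Fin u → Idx K V W) : ℤ := tWeight I - r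

lemma weight_shiftedWeight (r : ℤ) (d : (Fin u → Idx K V W) →₀ ℕ) :
    Finsupp.weight (shiftedWeight r) d = Finsupp.weight tWeight d - r * d.degree := by
  simp only [Finsupp.weight_apply, Finsupp.sum, shiftedWeight, Finsupp.degree_apply, smul_sub,
    Finset.sum_sub_distrib, Nat.cast_sum, Finset.mul_sum]
  congr 1
  exact Finset.sum_congr rfl fun i _ => by rw [nsmul_eq_mul, mul_comm]

end Cone

section Lift

variable {K : Type*} {V : Type*} {W : Type*} [Field K]
  [AddCommGroup V] [Module K V] [FiniteDimensional K V]
  [AddCommGroup W] [Module K W] [FiniteDimensional K W] {u : ℕ}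

lemma coords_torusAct (c : Kˣ) (φ : Fin u → V × W) :
    coords (torusAct c φ) = fun I => ((c ^ tWeight I : Kˣ) : K) * coords φ I :=
  funext fun I => plucker_torusAct c I φ

/-- An invariant section is a combination of monomials in the Plücker coordinates that are
themselves invariant. -/
lemma exists_lift_of_mem_invariantSections [CharZero K] {σ : ℚ} {m : ℕ} {F : TupleFun K V W u}
    (hF : F ∈ invariantSections K V W u σ m) :
    ∃ P : MvPolynomial (Fin u → Idx K V W) K, P.IsHomogeneous m ∧
      MvPolynomial.aeval (fun I => (plucker I : TupleFun K V W u)) P = F ∧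
      ∀ d ∈ P.support, (Finsupp.weight tWeight d : ℚ) = m * (u - 2 * σ) := by
  classical
  obtain ⟨hF1, rfl | ⟨e, he, hF2⟩⟩ := hF
  · exact ⟨0, MvPolynomial.isHomogeneous_zero _ _ _, map_zero _, by simp⟩
  rw [pluckerForms_pow_eq_map] at hF1
  obtain ⟨P, hP, rfl⟩ := hF1
  simp only [AlgHom.toLinearMap_apply, aeval_plucker_apply] at hF2
  refine ⟨MvPolynomial.weightedHomogeneousComponent tWeight e P, ?_, ?_, ?_⟩
  · intro d hd
    rw [MvPolynomial.coeff_weightedHomogeneousComponent] at hd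
    exact hP (fun h => hd (by simp [h]))
  · funext φ
    rw [AlgHom.toLinearMap_apply, aeval_plucker_apply, aeval_plucker_apply]
    rw [eval_weightedHomogeneousComponent tWeight (coords φ) P
      (MvPolynomial.eval (coords φ) P) e (fun c => ?_) e, if_pos rfl]
    rw [← coords_torusAct, hF2, mul_comm]
  · intro d hd
    rw [MvPolynomial.mem_support_iff, MvPolynomial.coeff_weightedHomogeneousComponent] at hd
    rw [← he, (ite_ne_right_iff.mp hd).1]

/-- Products of powers of two Plücker coordinates of the right weight are invariant sections. -/
lemma plucker_pow_mul_pow_mem {σ : ℚ} (I J : Fin u → Idx K V W) (a b : ℕ)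
    (h : (a : ℚ) * tWeight I + b * tWeight J = ((a + b : ℕ) : ℚ) * (u - 2 * σ)) :
    ((plucker I : TupleFun K V W u) ^ a * (plucker J : TupleFun K V W u) ^ b)
      ∈ invariantSections K V W u σ (a + b) := by
  refine ⟨?_, Or.inr ⟨a * tWeight I + b * tWeight J, by rw [← h]; push_cast; ring, fun c φ => ?_⟩⟩
  · rw [pow_add]
    exact Submodule.mul_mem_mul (Submodule.pow_mem_pow _ (plucker_mem_pluckerForms I) _)
      (Submodule.pow_mem_pow _ (plucker_mem_pluckerForms J) _)
  · simp only [Pi.mul_apply, Pi.pow_apply, plucker_torusAct, mul_pow, zpow_add, Units.val_mul]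
    rw [mul_comm (a : ℤ), mul_comm (b : ℤ), zpow_mul, zpow_mul, zpow_natCast, zpow_natCast,
      Units.val_pow_eq_pow_val, Units.val_pow_eq_pow_val]
    ring

/-- The map from the polynomial ring in the Plücker coordinates to the homogeneous coordinate ring
of the Grassmannian, the latter written as polynomials `∑ m, F_m X^m`. -/
def coneMap (K V W : Type*) [Field K] [AddCommGroup V] [Module K V] [FiniteDimensional K V]
    [AddCommGroup W] [Module K W] [FiniteDimensional K W] (u : ℕ) :
    MvPolynomial (Fin u → Idx K V W) K →ₐ[K] (TupleFun K V W u)[X] :=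
  MvPolynomial.aeval fun I => monomial 1 (plucker I : TupleFun K V W u)

lemma evalCone_coneMap (s : K) (φ : Fin u → V × W) (P : MvPolynomial (Fin u → Idx K V W) K) :
    evalCone s φ (coneMap K V W u P) = MvPolynomial.eval (s • coords φ) P := by
  induction P using MvPolynomial.induction_on with
  | C a => simp [coneMap, evalCone, Polynomial.algebraMap_apply]
  | add p q hp hq => simp [hp, hq]
  | mul_X p i hp =>
    rw [map_mul, map_mul, hp, coneMap, MvPolynomial.aeval_X, evalCone_monomial]
    simp [coords]

lemma coneMap_of_isHomogeneous [CharZero K] {P : MvPolynomial (Fin u → Idx K V W) K} {m : ℕ}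
    (hP : P.IsHomogeneous m) : coneMap K V W u P
      = monomial m (MvPolynomial.aeval (fun I => (plucker I : TupleFun K V W u)) P) :=
  eq_of_evalCone_eq fun s φ => by
    rw [evalCone_coneMap, evalCone_monomial, aeval_plucker_apply, eval_smul_of_isHomogeneous hP]

lemma coneMap_eq_zero_iff [CharZero K] {P : MvPolynomial (Fin u → Idx K V W) K} :
    coneMap K V W u P = 0 ↔
      ∀ (s : K) (φ : Fin u → V × W), MvPolynomial.eval (s • coords φ) P = 0 := by
  refine ⟨fun h s φ => by rw [← evalCone_coneMap, h, map_zero], fun h => ?_⟩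
  refine eq_of_evalCone_eq fun s φ => ?_
  rw [evalCone_coneMap, h, map_zero]

/-- The cone over the Grassmannian is stable under the torus, so its ideal is homogeneous for the
weights. -/
lemma coneMap_weightedHomogeneousComponent [CharZero K] {P : MvPolynomial (Fin u → Idx K V W) K}
    (hP : coneMap K V W u P = 0) (r n : ℤ) :
    coneMap K V W u (MvPolynomial.weightedHomogeneousComponent (shiftedWeight r) n P) = 0 := by
  rw [coneMap_eq_zero_iff] at hP ⊢
  intro s φ
  rw [eval_weightedHomogeneousComponent (shiftedWeight r) (s • coords φ) P 0 0 (fun c => ?_) n,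
    ite_self]
  -- The shift of the weights by `r` is a rescaling in the cone.
  rw [zero_mul, ← hP (((c ^ (-r) : Kˣ) : K) * s) (torusAct c φ)]
  congr 1
  congr 1
  funext I
  simp only [coords_torusAct, Pi.smul_apply, smul_eq_mul, shiftedWeight, sub_eq_add_neg, zpow_add,
    Units.val_mul]
  ring

lemma coneMap_mem_invariantRing [CharZero K] {σ : ℚ} {r : ℤ} (hr : (r : ℚ) = u - 2 * σ)
    {P : MvPolynomial (Fin u → Idx K V W) K}
    (hP : P.IsWeightedHomogeneous (shiftedWeight r) 0) :
    coneMap K V W u P ∈ invariantRing K V W u σ := by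
  rw [P.as_sum, map_sum]
  refine Subring.sum_mem _ fun d hd => ?_
  have hw := hP (MvPolynomial.mem_support_iff.mp hd)
  rw [weight_shiftedWeight, sub_eq_zero] at hw
  have hhom : (MvPolynomial.monomial d (P.coeff d)).IsHomogeneous d.degree :=
    MvPolynomial.isHomogeneous_monomial _ rfl
  rw [coneMap_of_isHomogeneous hhom]
  refine (homog σ d.degree _ ⟨?_, Or.inr ⟨r * d.degree, ?_, fun c φ => ?_⟩⟩).2
  · rw [pluckerForms_pow_eq_map]
    exact ⟨_, hhom, rfl⟩
  · push_cast; rw [hr]; ring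
  · rw [aeval_plucker_apply, aeval_plucker_apply, coords_torusAct, eval_monomial_torus, hw,
      mul_comm]

/-- Invariant sections lift to homogeneous polynomials of weight zero, for the weights shifted by
the linearization. -/
lemma exists_lift_isWeightedHomogeneous [CharZero K] {σ : ℚ} {r : ℤ} (hr : (r : ℚ) = u - 2 * σ)
    {m : ℕ} {F : TupleFun K V W u} (hF : F ∈ invariantSections K V W u σ m) :
    ∃ P : MvPolynomial (Fin u → Idx K V W) K, P.IsHomogeneous m ∧
      P.IsWeightedHomogeneous (shiftedWeight r) 0 ∧ coneMap K V W u P = monomial m F := by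
  obtain ⟨P, hP, rfl, hw⟩ := exists_lift_of_mem_invariantSections hF
  refine ⟨P, hP, fun d hd => ?_, coneMap_of_isHomogeneous hP⟩
  have h1 := hw d (MvPolynomial.mem_support_iff.mpr hd)
  have h2 : d.degree = m := by
    rw [Finsupp.degree_eq_weight_one]; exact hP hd
  rw [weight_shiftedWeight, h2, sub_eq_zero]
  rw [← hr] at h1
  have : (Finsupp.weight tWeight d : ℚ) = ((r * m : ℤ) : ℚ) := by rw [h1]; push_cast; ring
  exact_mod_cast this

end Lift

/-! ### Every closed point of the quotient is the class of a subspace -/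

section HomogeneousPrimes

variable {K : Type*} {V : Type*} {W : Type*} [Field K]
  [AddCommGroup V] [Module K V] [AddCommGroup W] [Module K W] {u : ℕ}

/-- A homogeneous ideal contains the homogeneous components of its elements. -/
lemma homog_coeff_mem {σ : ℚ} (q : ProjectiveSpectrum (grading K V W u σ))
    {p : invariantRing K V W u σ} (hp : p ∈ q.asHomogeneousIdeal.toIdeal) (n : ℕ) :
    homog σ n (p.1.coeff n) (p.2 n) ∈ q.asHomogeneousIdeal.toIdeal := by
  have h := q.asHomogeneousIdeal.isHomogeneous n hp
  convert h using 1
  apply Subtype.ext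
  ext1 j
  rw [coeff_decompose]
  simp only [homog, coeff_monomial, eq_comm (a := n)]
  split_ifs with h
  · rw [h]
  · rfl

lemma exists_homog_not_mem {σ : ℚ} (q : ProjectiveSpectrum (grading K V W u σ)) :
    ∃ m : ℕ, 0 < m ∧ ∃ (F : TupleFun K V W u) (hF : F ∈ invariantSections K V W u σ m),
      homog σ m F hF ∉ q.asHomogeneousIdeal.toIdeal := by
  classical
  by_contra! hall
  apply q.not_irrelevant_le
  intro b hb
  change b ∈ q.asHomogeneousIdeal.toIdeal
  rw [← DirectSum.sum_support_decompose (grading K V W u σ) b]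
  refine Ideal.sum_mem _ fun n _ => ?_
  rcases Nat.eq_zero_or_pos n with rfl | hn
  · have h := (HomogeneousIdeal.mem_irrelevant_iff _ b).mp hb
    rw [GradedRing.proj_apply] at h
    rw [h]
    exact Ideal.zero_mem _
  · rw [eq_homog (DirectSum.decompose (grading K V W u σ) b n).2]
    exact hall n hn _ _

end HomogeneousPrimes

section Surjectivity

variable {K : Type*} {V : Type*} {W : Type*} [Field K]
  [AddCommGroup V] [Module K V] [FiniteDimensional K V]
  [AddCommGroup W] [Module K W] [FiniteDimensional K W] {u : ℕ}

/-- The Plücker coordinates of a basis of `U` are unique up to a factor. -/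
lemma exists_coords_eq_smul_frame (U : Gr K V W u) {φ : Fin u → V × W}
    (hφ : LinearIndependent K φ) (hU : ∀ i, φ i ∈ U.1) :
    ∃ d : K, d ≠ 0 ∧ (coords φ : (Fin u → Idx K V W) → K) = d • coords (frame U) := by
  classical
  set b := Module.finBasisOfFinrankEq K U.1 U.2 with hb
  set ψ : Fin u → U.1 := fun i => ⟨φ i, hU i⟩ with hψ
  have hψli : LinearIndependent K ψ := LinearIndependent.of_comp U.1.subtype hφ
  refine ⟨b.det ψ, ?_, ?_⟩
  · have hspan : ⊤ ≤ Submodule.span K (Set.range ψ) :=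
      (hψli.span_eq_top_of_card_eq_finrank' (by rw [Fintype.card_fin]; exact U.2.symm)).ge
    exact ((b.is_basis_iff_det).mp ⟨hψli, hspan.antisymm' le_top⟩).ne_zero
  · funext I
    have h := ((plucker I).compLinearMap U.1.subtype).eq_smul_basis_det b
    have h2 := congrArg (fun ω => ω ψ) h
    simp only [AlternatingMap.smul_apply, smul_eq_mul] at h2
    rw [Pi.smul_apply, smul_eq_mul, mul_comm]
    exact h2

lemma linearIndependent_frame (U : Gr K V W u) : LinearIndependent K (frame U) :=
  (Module.finBasisOfFinrankEq K U.1 U.2).linearIndependent.map' U.1.subtype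
    (Submodule.ker_subtype _)

/-- Nonvanishing of a section at `U` can be tested on any basis of `U`. -/
lemma apply_eq_zero_iff_frame [CharZero K] (U : Gr K V W u) {φ : Fin u → V × W}
    (hφ : LinearIndependent K φ) (hU : ∀ i, φ i ∈ U.1) {m : ℕ} {F : TupleFun K V W u}
    (hF : F ∈ pluckerForms K V W u ^ m) : F φ = 0 ↔ F (frame U) = 0 := by
  obtain ⟨d, hd, hco⟩ := exists_coords_eq_smul_frame U hφ hU
  rw [pluckerForms_pow_eq_map] at hF
  obtain ⟨P, hP, rfl⟩ := hF
  rw [AlgHom.toLinearMap_apply, aeval_plucker_apply, aeval_plucker_apply, hco,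
    eval_smul_of_isHomogeneous hP]
  simp [hd]

lemma weightedHomogeneousComponent_mul_of_zero {τ : Type*} (w : τ → ℤ) (Q : MvPolynomial τ K)
    {G : MvPolynomial τ K} (hG : G.IsWeightedHomogeneous w 0) :
    MvPolynomial.weightedHomogeneousComponent w 0 (Q * G)
      = MvPolynomial.weightedHomogeneousComponent w 0 Q * G := by
  classical
  let _ := MvPolynomial.weightedGradedAlgebra K w
  have h := DirectSum.coe_decompose_mul_of_right_mem_zero
    (MvPolynomial.weightedHomogeneousSubmodule K w) (i := 0) (a := Q) (b := G) hG
  have happly : ∀ p, (DirectSum.decompose (MvPolynomial.weightedHomogeneousSubmodule K w) p 0 :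
      MvPolynomial τ K) = MvPolynomial.weightedHomogeneousComponent w 0 p := fun p =>
    MvPolynomial.weightedDecomposition.decompose'_apply K w p 0
  rwa [happly, happly] at h

variable [CharZero K]

/-- The ideal of the polynomial ring in the Plücker coordinates that is generated by the ideal of
the Grassmannian and by the invariant polynomials that represent elements of `q`. -/
def liftIdeal {σ : ℚ} {r : ℤ} (hr : (r : ℚ) = u - 2 * σ)
    (q : ProjectiveSpectrum (grading K V W u σ)) : Ideal (MvPolynomial (Fin u → Idx K V W) K) :=
  Ideal.span ({G | ∃ h : G.IsWeightedHomogeneous (shiftedWeight r) 0,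
    (⟨coneMap K V W u G, coneMap_mem_invariantRing hr h⟩ : invariantRing K V W u σ)
      ∈ q.asHomogeneousIdeal.toIdeal} ∪ {G | coneMap K V W u G = 0})

/-- The extension of `q` to the polynomial ring contracts to `q`. The projection to the part of
weight zero is linear over the invariants, hence serves as a Reynolds operator. -/
lemma mem_of_mem_liftIdeal {σ : ℚ} {r : ℤ} (hr : (r : ℚ) = u - 2 * σ)
    (q : ProjectiveSpectrum (grading K V W u σ)) {G : MvPolynomial (Fin u → Idx K V W) K}
    (hG : G.IsWeightedHomogeneous (shiftedWeight r) 0) (hGJ : G ∈ liftIdeal hr q) :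
    (⟨coneMap K V W u G, coneMap_mem_invariantRing hr hG⟩ : invariantRing K V W u σ)
      ∈ q.asHomogeneousIdeal.toIdeal := by
  -- The multiplier `Q` makes the claim stable under multiplication by arbitrary polynomials.
  have key : ∀ G ∈ liftIdeal hr q, ∀ Q : MvPolynomial (Fin u → Idx K V W) K,
      (⟨coneMap K V W u (MvPolynomial.weightedHomogeneousComponent (shiftedWeight r) 0 (Q * G)),
        coneMap_mem_invariantRing hr
          (MvPolynomial.weightedHomogeneousComponent_isWeightedHomogeneous 0 _)⟩ :
        invariantRing K V W u σ) ∈ q.asHomogeneousIdeal.toIdeal := by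
    intro G hG
    refine Submodule.span_induction ?_ ?_ ?_ ?_ hG
    · rintro G (⟨h, hq⟩ | hker) Q
      · have := Ideal.mul_mem_left _ (⟨coneMap K V W u
          (MvPolynomial.weightedHomogeneousComponent (shiftedWeight r) 0 Q),
          coneMap_mem_invariantRing hr
            (MvPolynomial.weightedHomogeneousComponent_isWeightedHomogeneous 0 _)⟩ :
          invariantRing K V W u σ) hq
        convert this using 1
        apply Subtype.ext
        simp only [weightedHomogeneousComponent_mul_of_zero _ Q h, map_mul]
        rfl
      · have h0 : coneMap K V W u (Q * G) = 0 := by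
          rw [map_mul, show coneMap K V W u G = 0 from hker, mul_zero]
        convert Ideal.zero_mem _ using 1
        exact Subtype.ext (coneMap_weightedHomogeneousComponent h0 r 0)
    · intro Q
      convert Ideal.zero_mem _ using 1
      apply Subtype.ext
      simp
    · intro G₁ G₂ _ _ h₁ h₂ Q
      convert Ideal.add_mem _ (h₁ Q) (h₂ Q) using 1
      apply Subtype.ext
      simp [mul_add]
    · intro a G _ h Q
      convert h (Q * a) using 1
      apply Subtype.ext
      simp [mul_assoc]
  convert key G hGJ 1 using 1
  apply Subtype.ext
  simp only [one_mul]
  congr 1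
  exact (MvPolynomial.IsWeightedHomogeneous.weightedHomogeneousComponent_same hG).symm

/-- The Plücker relations belong to the ideal of the cone over the Grassmannian. -/
lemma coneMap_relation (hu : 0 < u) (I₀ I : Fin u → Idx K V W) :
    coneMap K V W u (MvPolynomial.X I₀ ^ (u - 1) * MvPolynomial.X I
      - (Matrix.of fun i j => MvPolynomial.X (Function.update I₀ i (I j))).det) = 0 := by
  rw [coneMap_eq_zero_iff]
  intro s φ
  rw [map_sub, map_mul, map_pow, MvPolynomial.eval_X, MvPolynomial.eval_X, RingHom.map_det]
  have h : (MvPolynomial.eval (s • coords φ)).mapMatrix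
      (Matrix.of fun i j => MvPolynomial.X (Function.update I₀ i (I j)))
      = s • (Matrix.of fun i j => plucker (Function.update I₀ i (I j)) φ) := by
    ext i j
    simp [coords]
  rw [h, Matrix.det_smul, ← plucker_relation, Fintype.card_fin]
  obtain ⟨n, rfl⟩ : ∃ n, u = n + 1 := ⟨u - 1, by omega⟩
  simp only [Nat.add_sub_cancel, Pi.smul_apply, smul_eq_mul, coords]
  ring

/-- Surjectivity of the quotient map. By the Nullstellensatz the extension of the prime ideal of a
closed point to the polynomial ring in the Plücker coordinates has a zero outside the irrelevant
locus, and the Plücker relations turn this zero into a subspace. -/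
lemma exists_toQuotient_eq [IsAlgClosed K] {σ : ℚ} {r : ℤ} (hr : (r : ℚ) = u - 2 * σ) (hu : 0 < u)
    (y : Y K V W u σ) : ∃ (U : Gr K V W u) (hU : IsSemistable σ U), toQuotient σ U hU = y := by
  classical
  let q : ProjectiveSpectrum (grading K V W u σ) := y.1
  have hq : IsClosed ({q} : Set (ProjectiveSpectrum (grading K V W u σ))) := y.2
  obtain ⟨m, hm, F, hF, hFq⟩ := exists_homog_not_mem q
  obtain ⟨P, hP, hPw, hPF⟩ := exists_lift_isWeightedHomogeneous hr hF
  have hrad : P ∉ (liftIdeal hr q).radical := by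
    rintro ⟨n, hn⟩
    have hPn : (P ^ n).IsWeightedHomogeneous (shiftedWeight r) 0 := by simpa using hPw.pow n
    have h := mem_of_mem_liftIdeal hr q hPn hn
    refine hFq (q.isPrime.mem_of_pow_mem n ?_)
    convert h using 1
    apply Subtype.ext
    rw [SubmonoidClass.coe_pow]
    simp only [map_pow, hPF]
    rfl
  have hnull := MvPolynomial.vanishingIdeal_zeroLocus_eq_radical (K := K) (liftIdeal hr q)
  rw [← hnull, MvPolynomial.mem_vanishingIdeal_iff] at hrad
  push Not at hrad
  obtain ⟨x, hx, hxP⟩ := hrad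
  simp only [MvPolynomial.mem_zeroLocus_iff, MvPolynomial.aeval_eq_eval] at hx hxP
  replace hx : ∀ p ∈ liftIdeal hr q, MvPolynomial.eval x p = 0 := hx
  replace hxP : MvPolynomial.eval x P ≠ 0 := hxP
  obtain ⟨I₀, hI₀⟩ : ∃ I₀, x I₀ ≠ 0 := by
    by_contra! h
    apply hxP
    have : x = (0 : K) • x := by funext I; simp [h I]
    rw [this, eval_smul_of_isHomogeneous hP, zero_pow hm.ne', zero_mul]
  obtain ⟨φ, hφ⟩ := exists_coords_of_relation x I₀ hI₀ hu fun I => by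
    have h := hx _ (Ideal.subset_span (Or.inr (coneMap_relation hu I₀ I)))
    rw [map_sub, map_mul, map_pow, MvPolynomial.eval_X, MvPolynomial.eval_X, RingHom.map_det,
      sub_eq_zero] at h
    rw [h]
    congr 1
    ext i j
    simp
  have hli : LinearIndependent K φ := by
    by_contra hdep
    apply hI₀
    rw [hφ, Pi.smul_apply, coords, AlternatingMap.map_linearDependent _ _ hdep, smul_zero]
  let U : Gr K V W u := ⟨Submodule.span K (Set.range φ), by
    rw [finrank_span_eq_card hli, Fintype.card_fin]⟩
  obtain ⟨d, hd, hco⟩ := exists_coords_eq_smul_frame U hli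
    fun i => Submodule.subset_span (Set.mem_range_self i)
  have hxU : x = (x I₀ * d) • coords (frame U) := by rw [mul_smul, ← hco, ← hφ]
  have heval : ∀ {n : ℕ} {G : TupleFun K V W u} {Q : MvPolynomial (Fin u → Idx K V W) K},
      Q.IsHomogeneous n → coneMap K V W u Q = monomial n G →
      MvPolynomial.eval x Q = (x I₀ * d) ^ n * G (frame U) := by
    intro n G Q hQ hQG
    rw [coneMap_of_isHomogeneous hQ] at hQG
    rw [← monomial_injective n hQG, aeval_plucker_apply, ← eval_smul_of_isHomogeneous hQ, ← hxU]
  have hU : IsSemistable σ U := by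
    refine ⟨m, hm, F, hF, fun h => hxP ?_⟩
    rw [heval hP hPF, h, mul_zero]
  refine ⟨U, hU, ?_⟩
  -- The ideal of `U` contains `q`, hence equals it because `q` is a closed point.
  have hle : q ≤ schemePoint σ U hU := by
    rw [← ProjectiveSpectrum.as_ideal_le_as_ideal]
    intro p hp
    refine (mem_schemePoint hU p).mpr ?_
    ext n
    rw [coeff_evalAt, coeff_zero]
    obtain ⟨Q, hQ, hQw, hQp⟩ := exists_lift_isWeightedHomogeneous hr (p.2 n)
    have h1 := hx Q (Ideal.subset_span (Or.inl ⟨hQw, by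
      convert homog_coeff_mem q hp n using 1
      exact Subtype.ext hQp⟩))
    rw [heval hQ hQp] at h1
    exact (mul_eq_zero.mp h1).resolve_left (pow_ne_zero _ (mul_ne_zero hI₀ hd))
  have hmem := (ProjectiveSpectrum.le_iff_mem_closure _ _ _).mp hle
  rw [hq.closure_eq, Set.mem_singleton_iff] at hmem
  exact Subtype.ext hmem

end Surjectivity

/-! ### Ranks and Plücker coordinates -/

section Rank

variable {K : Type*} [Field K] {u : ℕ}

/-- Row rank equals column rank, for the coordinate matrix of a tuple of vectors. -/
lemma finrank_span_coord {α M : Type*} [Fintype α] [AddCommGroup M] [Module K M]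
    (b : Module.Basis α K M) (ψ : Fin u → M) :
    Module.finrank K (Submodule.span K (Set.range fun a j => b.coord a (ψ j)))
      = Module.finrank K (Submodule.span K (Set.range ψ)) := by
  classical
  set A : Matrix (Fin u) α K := Matrix.of fun j a => b.coord a (ψ j) with hA
  have h1 := A.rank_eq_finrank_span_cols
  have h2 := A.rank_eq_finrank_span_row
  have hrow : A.row = b.equivFun ∘ ψ := by
    funext j a
    simp [hA, Matrix.row]
  have hcol : A.col = fun a j => b.coord a (ψ j) := rfl
  rw [hcol] at h1
  rw [hrow, Set.range_comp] at h2
  rw [← h1, h2]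
  have h3 : Submodule.span K (b.equivFun '' Set.range ψ)
      = (Submodule.span K (Set.range ψ)).map b.equivFun.toLinearMap :=
    (Submodule.map_span _ _).symm
  rw [h3]
  exact LinearEquiv.finrank_map_eq b.equivFun _

variable {V : Type*} {W : Type*}
  [AddCommGroup V] [Module K V] [AddCommGroup W] [Module K W]

lemma wDeg_eq_ncard (I : Fin u → Idx K V W) :
    wDeg I = {i | I i ∈ Set.range (Sum.inr : _ → Idx K V W)}.ncard := by
  classical
  rw [wDeg, ← Set.ncard_coe_finset]
  congr 1
  ext i
  rcases h : I i with a | a <;> simp [h]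

variable [FiniteDimensional K V] [FiniteDimensional K W]

/-- The column with index `a` of the coordinate matrix of the tuple `φ`. -/
def coordCol (φ : Fin u → V × W) (a : Idx K V W) : Fin u → K :=
  fun j => (coordBasis K V W).coord a (φ j)

lemma plucker_ne_zero_iff (φ : Fin u → V × W) (I : Fin u → Idx K V W) :
    plucker I φ ≠ 0 ↔ LinearIndependent K (coordCol φ ∘ I) := by
  rw [plucker_apply, ← isUnit_iff_ne_zero, ← Matrix.isUnit_iff_isUnit_det,
    ← Matrix.linearIndependent_cols_iff_isUnit]
  rfl

lemma coordCol_comp_inl (φ : Fin u → V × W) : (coordCol φ ∘ Sum.inl : _ → Fin u → K)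
    = fun a j => (Module.finBasis K V).coord a (φ j).1 := by
  funext a j
  simp [coordCol, coordBasis]

lemma coordCol_comp_inr (φ : Fin u → V × W) : (coordCol φ ∘ Sum.inr : _ → Fin u → K)
    = fun a j => (Module.finBasis K W).coord a (φ j).2 := by
  funext a j
  simp [coordCol, coordBasis]

/-- The exchange lemma, for the columns of the coordinate matrix: there is a nonvanishing minor with
columns in `B` of which as many as possible belong to `A`. -/
lemma exists_plucker_ne_zero (φ : Fin u → V × W) {A B : Set (Idx K V W)} (hAB : A ⊆ B)
    (hB : Submodule.span K (coordCol φ '' B) = ⊤) :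
    ∃ I : Fin u → Idx K V W, plucker I φ ≠ 0 ∧ (∀ i, I i ∈ B) ∧
      Module.finrank K (Submodule.span K (coordCol φ '' A)) ≤ {i | I i ∈ A}.ncard := by
  classical
  obtain ⟨s, hsA, -, hspan, hsli⟩ := exists_linearIndepOn_extension
    (linearIndepOn_empty K (coordCol (K := K) φ)) (Set.empty_subset A)
  obtain ⟨t, htB, hst, htspan, htli⟩ := exists_linearIndepOn_extension hsli (hsA.trans hAB)
  have ht : Submodule.span K (coordCol φ '' t) = ⊤ := by
    rw [eq_top_iff, ← hB]
    exact Submodule.span_le.mpr htspan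
  have hcard : ∀ r : Set (Idx K V W), LinearIndepOn K (coordCol φ) r →
      Module.finrank K (Submodule.span K (coordCol φ '' r)) = Fintype.card r := by
    intro r hr
    rw [Set.image_eq_range]
    exact finrank_span_eq_card hr
  have htc : Fintype.card t = u := by
    rw [← hcard t htli, ht, finrank_top, Module.finrank_fin_fun]
  let e : Fin u ≃ t := (Fintype.equivFinOfCardEq htc).symm
  refine ⟨fun i => e i, ?_, fun i => htB (e i).2, ?_⟩
  · rw [plucker_ne_zero_iff]
    exact LinearIndependent.comp htli e e.injective
  · have h1 : Submodule.span K (coordCol φ '' A) ≤ Submodule.span K (coordCol φ '' s) :=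
      Submodule.span_le.mpr hspan
    refine (Submodule.finrank_mono h1).trans ?_
    rw [hcard s hsli, ← Nat.card_eq_fintype_card, Nat.card_coe_set_eq]
    have h2 : s ⊆ (fun i => (e i : Idx K V W)) '' {i | (e i : Idx K V W) ∈ A} := by
      intro a ha
      exact ⟨e.symm ⟨a, hst ha⟩, by simpa using hsA ha, by simp⟩
    exact (Set.ncard_le_ncard h2 (Set.toFinite _)).trans (Set.ncard_image_le (Set.toFinite _))

/-- If `φ` projects to a linearly independent tuple in `V`, some minor without coordinates of `W`
does not vanish. -/
lemma exists_plucker_ne_zero_of_fst {φ : Fin u → V × W}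
    (hφ : LinearIndependent K fun i => (φ i).1) :
    ∃ I : Fin u → Idx K V W, wDeg I = 0 ∧ plucker I φ ≠ 0 := by
  obtain ⟨I, hI, hIB, -⟩ := exists_plucker_ne_zero (K := K) φ
    (Set.empty_subset (Set.range Sum.inl)) (by
      rw [← Set.range_comp, coordCol_comp_inl]
      apply Submodule.eq_top_of_finrank_eq
      rw [finrank_span_coord (Module.finBasis K V) fun j => (φ j).1, finrank_span_eq_card hφ]
      simp)
  refine ⟨I, ?_, hI⟩
  rw [wDeg, Finset.card_eq_zero, Finset.filter_eq_empty_iff]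
  intro i _
  obtain ⟨a, ha⟩ := hIB i
  simp [← ha]

lemma linearIndependent_fst_of_plucker_ne_zero {φ : Fin u → V × W} {I : Fin u → Idx K V W}
    (hI : wDeg I = 0) (h : plucker I φ ≠ 0) : LinearIndependent K fun i => (φ i).1 := by
  rw [wDeg, Finset.card_eq_zero, Finset.filter_eq_empty_iff] at hI
  rw [Fintype.linearIndependent_iff]
  intro g hg
  rw [plucker_apply] at h
  refine fun i => congrFun (Matrix.eq_zero_of_vecMul_eq_zero h (v := g) ?_) i
  funext i
  obtain ⟨a, ha⟩ : ∃ a, I i = Sum.inl a := by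
    have := hI (Finset.mem_univ i)
    rcases h : I i with a | a
    · exact ⟨a, rfl⟩
    · simp [h] at this
  have h2 := congrArg ((Module.finBasis K V).coord a) hg
  simpa [Matrix.vecMul, dotProduct, ha, coordBasis] using h2

/-- The rank of the projection to `W` is the largest number of coordinates of `W` in a
nonvanishing Plücker coordinate. -/
lemma forall_plucker_eq_zero_iff {φ : Fin u → V × W} (hφ : LinearIndependent K φ) (N : ℕ) :
    (∀ I : Fin u → Idx K V W, N < wDeg I → plucker I φ = 0) ↔
      Module.finrank K (Submodule.span K (Set.range fun i => (φ i).2)) ≤ N := by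
  classical
  rw [← finrank_span_coord (Module.finBasis K W) fun i => (φ i).2, ← coordCol_comp_inr,
    Set.range_comp]
  refine ⟨fun h => ?_, fun h I hI => ?_⟩
  · obtain ⟨I, hI, -, hcard⟩ := exists_plucker_ne_zero (K := K) φ
      (Set.subset_univ (Set.range Sum.inr)) (by
        rw [Set.image_univ]
        apply Submodule.eq_top_of_finrank_eq
        have := finrank_span_coord (coordBasis K V W) φ
        rw [finrank_span_eq_card hφ] at this
        refine this.trans ?_
        simp)
    rw [← wDeg_eq_ncard] at hcard
    by_contra hN
    exact hI (h I (by omega))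
  · by_contra hne
    rw [← ne_eq, plucker_ne_zero_iff] at hne
    have hli := LinearIndependent.comp hne
      (Subtype.val : {i | I i ∈ Set.range (Sum.inr : _ → Idx K V W)} → Fin u)
      Subtype.val_injective
    have h1 := finrank_span_eq_card hli
    rw [← Nat.card_eq_fintype_card, Nat.card_coe_set_eq, ← wDeg_eq_ncard] at h1
    have h2 := Submodule.finrank_mono (R := K) (Submodule.span_mono (R := K)
      (show Set.range ((coordCol φ ∘ I) ∘ Subtype.val)
        ⊆ coordCol φ '' Set.range (Sum.inr : _ → Idx K V W) by
          rintro _ ⟨⟨i, hi⟩, rfl⟩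
          exact ⟨I i, hi, rfl⟩))
    exact hI.not_ge ((h1.symm.le.trans h2).trans h)

lemma span_range_frame (U : Gr K V W u) : Submodule.span K (Set.range (frame U)) = U.1 := by
  have h := congrArg (Submodule.map U.1.subtype) (Module.finBasisOfFinrankEq K U.1 U.2).span_eq
  rw [Submodule.map_span, ← Set.range_comp, Submodule.map_top, Submodule.range_subtype] at h
  exact h

lemma forall_plucker_frame_eq_zero_iff (U : Gr K V W u) (N : ℕ) :
    (∀ I : Fin u → Idx K V W, N < wDeg I → plucker I (frame U) = 0) ↔
      Module.finrank K (U.1.map (LinearMap.snd K V W)) ≤ N := by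
  rw [forall_plucker_eq_zero_iff (linearIndependent_frame U), ← span_range_frame U,
    Submodule.map_span, ← Set.range_comp]
  rfl

end Rank

/-! ### Semistability -/

section Semistable

variable {K : Type*} {V : Type*} {W : Type*} [Field K]
  [AddCommGroup V] [Module K V] [FiniteDimensional K V]
  [AddCommGroup W] [Module K W] [FiniteDimensional K W] {u : ℕ}

/-- The numerical criterion: at a semistable point, the weights of the nonvanishing Plücker
coordinates lie on both sides of the linearization. -/
lemma IsSemistable.exists_plucker_ne_zero [CharZero K] {σ : ℚ} {U : Gr K V W u}
    (hU : IsSemistable σ U) :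
    (∃ I : Fin u → Idx K V W, (wDeg I : ℚ) ≤ σ ∧ plucker I (frame U) ≠ 0) ∧
      ∃ I : Fin u → Idx K V W, σ ≤ wDeg I ∧ plucker I (frame U) ≠ 0 := by
  obtain ⟨m, hm, F, hF, hne⟩ := hU
  obtain ⟨P, hP, rfl, hw⟩ := exists_lift_of_mem_invariantSections hF
  rw [aeval_plucker_apply, MvPolynomial.eval_eq] at hne
  obtain ⟨d, hd, hd0⟩ := Finset.exists_ne_zero_of_sum_ne_zero hne
  have hne' : ∀ I ∈ d.support, plucker I (frame U) ≠ 0 := fun I hI h0 =>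
    right_ne_zero_of_mul hd0 (Finset.prod_eq_zero hI (by
      rw [coords, h0, zero_pow (Finsupp.mem_support_iff.mp hI)]))
  have hdeg : ∑ I ∈ d.support, d I = m := by
    rw [← hP (MvPolynomial.mem_support_iff.mp hd), Finsupp.weight_apply, Finsupp.sum]
    simp
  have hdegQ : ∑ I ∈ d.support, (d I : ℚ) = m := by exact_mod_cast hdeg
  have hsum : ∑ I ∈ d.support, (d I : ℚ) * wDeg I = ∑ I ∈ d.support, (d I : ℚ) * σ := by
    have h1 := hw d hd
    rw [Finsupp.weight_apply, Finsupp.sum, Int.cast_sum] at h1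
    simp only [tWeight, nsmul_eq_mul, Int.cast_mul, Int.cast_natCast, Int.cast_sub,
      Int.cast_ofNat] at h1
    have h2 : ∑ I ∈ d.support, (d I : ℚ) * (u - 2 * wDeg I)
        = (∑ I ∈ d.support, (d I : ℚ)) * u - 2 * ∑ I ∈ d.support, (d I : ℚ) * wDeg I := by
      rw [Finset.sum_mul, Finset.mul_sum, ← Finset.sum_sub_distrib]
      exact Finset.sum_congr rfl fun I _ => by ring
    rw [h2, hdegQ] at h1
    rw [← Finset.sum_mul, hdegQ]
    linarith
  have hnonempty : d.support.Nonempty := by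
    rw [Finset.nonempty_iff_ne_empty]
    rintro h
    rw [h, Finset.sum_empty] at hdeg
    omega
  have hpos : ∀ I ∈ d.support, (0 : ℚ) < d I := fun I hI => by
    exact_mod_cast Nat.pos_of_ne_zero (Finsupp.mem_support_iff.mp hI)
  obtain ⟨I, hI, hIle⟩ := Finset.exists_le_of_sum_le hnonempty hsum.le
  obtain ⟨J, hJ, hJle⟩ := Finset.exists_le_of_sum_le hnonempty hsum.ge
  exact ⟨⟨I, le_of_mul_le_mul_left hIle (hpos I hI), hne' I hI⟩,
    ⟨J, le_of_mul_le_mul_left hJle (hpos J hJ), hne' J hJ⟩⟩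

/-- Two Plücker coordinates whose weights lie on different sides of the linearization have a
monomial that is an invariant section. -/
lemma exists_pow_mul_pow_mem_invariantSections {σ : ℚ} {n : ℕ} (hσ : σ = n - 1 / 2)
    {I J : Fin u → Idx K V W} (hI : wDeg I < n) (hJ : n ≤ wDeg J) :
    ∃ a b : ℕ, 0 < a ∧ 0 < b ∧
      ((plucker I : TupleFun K V W u) ^ a * (plucker J : TupleFun K V W u) ^ b)
        ∈ invariantSections K V W u σ (a + b) := by
  obtain ⟨α, hα⟩ := Nat.exists_eq_add_of_lt hI
  obtain ⟨β, hβ⟩ := Nat.exists_eq_add_of_le hJ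
  -- With the linearization at `n - 1 / 2`, the weights of the two coordinates are proportional to
  -- `2 * α + 1` and `-(2 * β + 1)`.
  refine ⟨2 * β + 1, 2 * α + 1, by omega, by omega, plucker_pow_mul_pow_mem I J _ _ ?_⟩
  have h1 : (wDeg I : ℚ) = n - α - 1 := by rw [hα]; push_cast; ring
  have h2 : (wDeg J : ℚ) = n + β := by rw [hβ]; push_cast; ring
  rw [tWeight, tWeight, hσ]
  push_cast
  rw [h1, h2]
  ring

lemma isSemistable_iff [CharZero K] {σ : ℚ} {n : ℕ} (hσ : σ = n - 1 / 2) (U : Gr K V W u) :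
    IsSemistable σ U ↔ (∃ I : Fin u → Idx K V W, wDeg I < n ∧ plucker I (frame U) ≠ 0) ∧
      ∃ I : Fin u → Idx K V W, n ≤ wDeg I ∧ plucker I (frame U) ≠ 0 := by
  refine ⟨fun h => ?_, ?_⟩
  · obtain ⟨⟨I, hI, hI0⟩, ⟨J, hJ, hJ0⟩⟩ := h.exists_plucker_ne_zero
    refine ⟨⟨I, ?_, hI0⟩, ⟨J, ?_, hJ0⟩⟩
    · have : (wDeg I : ℚ) < n := by linarith
      exact_mod_cast this
    · have : (n : ℚ) < (wDeg J + 1 : ℕ) := by push_cast; linarith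
      exact Nat.lt_succ_iff.mp (by exact_mod_cast this)
  · rintro ⟨⟨I, hI, hI0⟩, ⟨J, hJ, hJ0⟩⟩
    obtain ⟨a, b, ha, -, hmem⟩ := exists_pow_mul_pow_mem_invariantSections hσ hI hJ
    exact ⟨a + b, by omega, _, hmem, mul_ne_zero (pow_ne_zero _ hI0) (pow_ne_zero _ hJ0)⟩

/-- A subspace on which a Plücker coordinate does not vanish is semistable for the linearization
that makes this coordinate invariant. -/
lemma isSemistable_of_plucker_ne_zero {U : Gr K V W u} {I : Fin u → Idx K V W}
    (hI : plucker I (frame U) ≠ 0) : IsSemistable (wDeg I : ℚ) U := by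
  refine ⟨1 + 0, by omega, _, plucker_pow_mul_pow_mem I I 1 0 ?_, by simpa using hI⟩
  rw [tWeight]
  push_cast
  ring

end Semistable

/-! ### The loci of bounded rank in the quotients -/

section RankLocus

lemma isClosed_setOf_homog_mem {K V W : Type*} [Field K] [AddCommGroup V] [Module K V]
    [AddCommGroup W] [Module K W] {u : ℕ} {σ : ℚ} {m : ℕ} {F : TupleFun K V W u}
    (hF : F ∈ invariantSections K V W u σ m) :
    IsClosed {y : Y K V W u σ | homog σ m F hF ∈
      (y.1 : ProjectiveSpectrum (grading K V W u σ)).asHomogeneousIdeal.toIdeal} := by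
  have h := ProjectiveSpectrum.isClosed_zeroLocus (grading K V W u σ) {homog σ m F hF}
  have h2 : IsClosed ((Subtype.val : Y K V W u σ → mumfordQuotient K V W u σ) ⁻¹'
      (ProjectiveSpectrum.zeroLocus (grading K V W u σ) {homog σ m F hF})) :=
    IsClosed.preimage continuous_subtype_val h
  convert h2 using 1
  ext y
  change _ ↔ ({homog σ m F hF} : Set (invariantRing K V W u σ)) ⊆
    (y.1 : ProjectiveSpectrum (grading K V W u σ)).asHomogeneousIdeal
  rw [Set.singleton_subset_iff]
  rfl

variable {K : Type*} {V : Type*} {W : Type*} [Field K]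
  [AddCommGroup V] [Module K V] [FiniteDimensional K V]
  [AddCommGroup W] [Module K W] [FiniteDimensional K W] {u : ℕ}

lemma homog_mem_toQuotient_iff {σ : ℚ} {m : ℕ} {F : TupleFun K V W u}
    (hF : F ∈ invariantSections K V W u σ m) {U : Gr K V W u} (hU : IsSemistable σ U) :
    homog σ m F hF ∈ ((toQuotient σ U hU).1 :
      ProjectiveSpectrum (grading K V W u σ)).asHomogeneousIdeal.toIdeal ↔ F (frame U) = 0 := by
  refine (mem_schemePoint hU _).trans ?_
  rw [evalAt_homog, monomial_eq_zero_iff]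

variable (K V W u) in
/-- The classes of the semistable subspaces whose projection to `W` has rank at most `N`. The rank
is expressed through Plücker coordinates. -/
def rankLocus (σ : ℚ) (N : ℕ) : Set (Y K V W u σ) :=
  {y | ∃ (U : Gr K V W u) (hU : IsSemistable σ U),
    (∀ I : Fin u → Idx K V W, N < wDeg I → plucker I (frame U) = 0) ∧ toQuotient σ U hU = y}

/-- The invariant sections cut out the condition on the rank, so that it holds for all points of a
class, and on the closure of the locus, if it holds for one representative. -/
lemma forall_plucker_eq_zero_of_mem_closure [CharZero K] {σ : ℚ} {n N : ℕ} (hσ : σ = n - 1 / 2)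
    (hn : n ≤ N) {U : Gr K V W u} (hU : IsSemistable σ U)
    (h : toQuotient σ U hU ∈ closure (rankLocus K V W u σ N)) (J : Fin u → Idx K V W)
    (hJ : N < wDeg J) : plucker J (frame U) = 0 := by
  obtain ⟨⟨I, hI, hI0⟩, -⟩ := (isSemistable_iff hσ U).mp hU
  obtain ⟨a, b, ha, hb, hmem⟩ := exists_pow_mul_pow_mem_invariantSections hσ hI (hn.trans hJ.le)
  have hsub : rankLocus K V W u σ N ⊆ {y : Y K V W u σ | homog σ _ _ hmem ∈
      (y.1 : ProjectiveSpectrum (grading K V W u σ)).asHomogeneousIdeal.toIdeal} := by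
    rintro _ ⟨U', hU', hvan, rfl⟩
    refine (homog_mem_toQuotient_iff hmem hU').mpr ?_
    rw [Pi.mul_apply, Pi.pow_apply, Pi.pow_apply, hvan J hJ, zero_pow hb.ne', mul_zero]
  have h1 := closure_minimal hsub (isClosed_setOf_homog_mem hmem) h
  have h2 := (homog_mem_toQuotient_iff hmem hU).mp h1
  exact eq_zero_of_pow_eq_zero ((mul_eq_zero.mp h2).resolve_left (pow_ne_zero _ hI0))

lemma isClosed_rankLocus [CharZero K] [IsAlgClosed K] {σ : ℚ} {n N : ℕ} (hσ : σ = n - 1 / 2)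
    (hn : n ≤ N) (hu : 0 < u) : IsClosed (rankLocus K V W u σ N) := by
  rw [← closure_subset_iff_isClosed]
  intro y hy
  obtain ⟨U, hU, rfl⟩ := exists_toQuotient_eq (r := u - 2 * n + 1)
    (by rw [hσ]; push_cast; ring) hu y
  exact ⟨U, hU, forall_plucker_eq_zero_of_mem_closure hσ hn hU hy, rfl⟩

/-- Instability for all `σ > k` means that all Plücker coordinates with more than `k` coordinates of
`W` vanish. -/
lemma Zminus_eq_rankLocus [CharZero K] (k : ℕ) :
    Zminus K V W u k = rankLocus K V W u (k - 1 / 2) k := by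
  ext y
  constructor
  · rintro ⟨U, hU, huns, rfl⟩
    refine ⟨U, hU, fun I hI => ?_, rfl⟩
    by_contra hne
    exact huns _ (by exact_mod_cast hI) (isSemistable_of_plucker_ne_zero hne)
  · rintro ⟨U, hU, hvan, rfl⟩
    refine ⟨U, hU, fun σ hσ hss => ?_, rfl⟩
    obtain ⟨-, I, hI, hne⟩ := hss.exists_plucker_ne_zero
    exact hne (hvan I (by exact_mod_cast hσ.trans_le hI))

end RankLocus

/-! ### General position -/

section Density

variable {K : Type*} {V : Type*} {W : Type*} [Field K]
  [AddCommGroup V] [Module K V] [FiniteDimensional K V]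
  [AddCommGroup W] [Module K W] [FiniteDimensional K W] {u : ℕ}

/-- Membership in a closure is tested by homogeneous invariant sections. -/
lemma toQuotient_mem_closure {σ : ℚ} {U : Gr K V W u} (hU : IsSemistable σ U)
    {S : Set (Y K V W u σ)}
    (h : ∀ (n : ℕ) (F : TupleFun K V W u), F ∈ invariantSections K V W u σ n → F (frame U) ≠ 0 →
      ∃ (U' : Gr K V W u) (hU' : IsSemistable σ U'),
        toQuotient σ U' hU' ∈ S ∧ F (frame U') ≠ 0) :
    toQuotient σ U hU ∈ closure S := by
  suffices key : schemePoint σ U hU ∈ closure {q : ProjectiveSpectrum (grading K V W u σ) |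
      ∃ y : Y K V W u σ, y ∈ S ∧ (y.1 : ProjectiveSpectrum (grading K V W u σ)) = q} from
    closure_subtype.mpr key
  rw [closure, Set.mem_sInter]
  rintro C ⟨hC, hSC⟩
  obtain ⟨s, rfl⟩ := (ProjectiveSpectrum.isClosed_iff_zeroLocus _ _).mp hC
  rw [ProjectiveSpectrum.mem_zeroLocus]
  intro f hf
  refine (mem_schemePoint hU f).mpr ?_
  ext n
  rw [coeff_evalAt, coeff_zero]
  by_contra hne
  obtain ⟨U', hU', hS, hne'⟩ := h n _ (f.2 n) hne
  have h1 := (ProjectiveSpectrum.mem_zeroLocus _ _ _).mp (hSC ⟨_, hS, rfl⟩) hf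
  have h2 := (mem_schemePoint hU' f).mp h1
  apply hne'
  rw [← coeff_evalAt, h2, coeff_zero]

/-- Sections of powers of the Plücker bundle are polynomial along lines in the space of tuples. -/
lemma exists_polynomial_eval_eq [CharZero K] {m : ℕ} {F : TupleFun K V W u}
    (hF : F ∈ pluckerForms K V W u ^ m) (φ ψ : Fin u → V × W) :
    ∃ Q : K[X], ∀ t : K, Q.eval t = F (φ + t • ψ) := by
  classical
  rw [pluckerForms_pow_eq_map] at hF
  obtain ⟨P, -, rfl⟩ := hF
  let q : (Fin u → Idx K V W) → K[X] := fun I => (Matrix.of fun j i =>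
    C ((coordBasis K V W).coord (I i) (φ j)) + X * C ((coordBasis K V W).coord (I i) (ψ j))).det
  have hq : ∀ I t, (q I).eval t = plucker I (φ + t • ψ) := by
    intro I t
    rw [plucker_apply, ← coe_evalRingHom, RingHom.map_det]
    congr 1
    ext j i
    simp [mul_comm t]
  refine ⟨MvPolynomial.aeval q P, fun t => ?_⟩
  rw [AlgHom.toLinearMap_apply, aeval_plucker_apply]
  induction P using MvPolynomial.induction_on with
  | C a => simp
  | add p q hp hq => simp [hp, hq]
  | mul_X p i hp => simp [hp, hq, coords]

/-- A tuple of vectors becomes linearly independent after a general displacement in the direction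
of a linearly independent tuple. -/
lemma exists_polynomial_linearIndependent {K V : Type*} [Field K] [AddCommGroup V] [Module K V]
    {u : ℕ} {v e : Fin u → V} (he : LinearIndependent K e) :
    ∃ Q : K[X], Q ≠ 0 ∧ ∀ t : K, Q.eval t ≠ 0 → LinearIndependent K (v + t • e) := by
  classical
  obtain ⟨g, hg⟩ := (Fintype.linearCombination K e).exists_leftInverse_of_injective
    (LinearMap.ker_eq_bot.mpr he.fintypeLinearCombination_injective)
  have hge : ∀ j, g (e j) = Pi.single j 1 := fun j => by
    have := LinearMap.congr_fun hg (Pi.single j 1)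
    simpa using this
  -- In the coordinates `g` the displaced tuple is the matrix `A + t`, singular only at the
  -- eigenvalues of `-A`.
  let A : Matrix (Fin u) (Fin u) K := Matrix.of fun j => g (v j)
  refine ⟨(-A).charpoly, (-A).charpoly_monic.ne_zero, fun t ht => ?_⟩
  rw [Matrix.eval_charpoly, ← isUnit_iff_ne_zero, ← Matrix.isUnit_iff_isUnit_det,
    ← Matrix.linearIndependent_rows_iff_isUnit] at ht
  refine LinearIndependent.of_comp g ?_
  have hrow : g ∘ (v + t • e) = (Matrix.scalar (Fin u) t - -A).row := by
    funext j i
    simp [Matrix.row, A, hge, Matrix.scalar_apply, Matrix.diagonal_apply, Pi.single_apply, eq_comm,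
      add_comm]
  rw [hrow]
  exact ht

/-- Every class of rank `k` is a limit of classes of rank `k` that are also semistable for `1 / 2`.
A basis of the subspace is displaced in the direction of `V`, which leaves the projection to `W`
unchanged and makes the projection to `V` injective. -/
lemma rankLocus_subset_properTransform [CharZero K] {σ : ℚ} {k : ℕ} (hσ : σ = k - 1 / 2)
    (hk : 1 ≤ k) (huV : u ≤ Module.finrank K V) :
    rankLocus K V W u σ k
      ⊆ properTransform (1 / 2) σ (rankLocus K V W u (1 / 2) k) := by
  rintro _ ⟨U, hU, hvan, rfl⟩
  refine toQuotient_mem_closure hU fun n F hF hne => ?_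
  obtain ⟨m, hm, G, hG, hGne⟩ := id hU
  obtain ⟨e, he⟩ : ∃ e : Fin u → V, LinearIndependent K e :=
    ⟨_, (Module.finBasis K V).linearIndependent.comp (Fin.castLE huV) (Fin.castLE_injective huV)⟩
  let ψ : Fin u → V × W := fun j => (e j, 0)
  -- The displaced tuple has to avoid the zeros of `F`, to stay semistable, which `G` witnesses, and
  -- to have an injective projection to `V`.
  obtain ⟨Q₁, hQ₁⟩ := exists_polynomial_eval_eq hF.1 (frame U) ψ
  obtain ⟨Q₂, hQ₂⟩ := exists_polynomial_eval_eq hG.1 (frame U) ψ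
  obtain ⟨Q₃, hQ₃0, hQ₃⟩ := exists_polynomial_linearIndependent (v := fun j => (frame U j).1) he
  have hQ₁0 : Q₁ ≠ 0 := fun h => hne (by simpa [h] using (hQ₁ 0).symm)
  have hQ₂0 : Q₂ ≠ 0 := fun h => hGne (by simpa [h] using (hQ₂ 0).symm)
  obtain ⟨t, ht⟩ : ∃ t : K, (Q₁ * Q₂ * Q₃).eval t ≠ 0 := by
    by_contra! h
    exact mul_ne_zero (mul_ne_zero hQ₁0 hQ₂0) hQ₃0 (Polynomial.funext fun t => by simpa using h t)
  rw [eval_mul, eval_mul, hQ₁, hQ₂] at ht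
  have hfst := hQ₃ t (right_ne_zero_of_mul ht)
  set φ := frame U + t • ψ with hφ
  have hfst' : LinearIndependent K fun j => (φ j).1 := hfst
  have hli : LinearIndependent K φ := LinearIndependent.of_comp (LinearMap.fst K V W) hfst'
  let U' : Gr K V W u := ⟨Submodule.span K (Set.range φ), by
    rw [finrank_span_eq_card hli, Fintype.card_fin]⟩
  have hmem : ∀ i, φ i ∈ U'.1 := fun i => Submodule.subset_span (Set.mem_range_self i)
  have hpl : ∀ I : Fin u → Idx K V W, plucker I φ = 0 ↔ plucker I (frame U') = 0 := fun I =>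
    apply_eq_zero_iff_frame (m := 1) U' hli hmem (by
      rw [pow_one]; exact plucker_mem_pluckerForms I)
  have hU' : IsSemistable σ U' := ⟨m, hm, G, hG, fun h =>
    right_ne_zero_of_mul (left_ne_zero_of_mul ht)
      ((apply_eq_zero_iff_frame U' hli hmem hG.1).mpr h)⟩
  have hhalf : IsSemistable (1 / 2) U' := by
    rw [isSemistable_iff (n := 1) (by norm_num)]
    obtain ⟨-, J, hJ, hJ0⟩ := (isSemistable_iff hσ U').mp hU'
    obtain ⟨I, hI, hI0⟩ := exists_plucker_ne_zero_of_fst hfst'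
    exact ⟨⟨I, by omega, fun h => hI0 ((hpl I).mpr h)⟩, ⟨J, hk.trans hJ, hJ0⟩⟩
  refine ⟨U', hU', ⟨U', hhalf, hU', ⟨U', hhalf, fun I hI => ?_, rfl⟩, rfl⟩, fun h =>
    left_ne_zero_of_mul (left_ne_zero_of_mul ht) ((apply_eq_zero_iff_frame U' hli hmem hF.1).mpr h)⟩
  rw [← hpl]
  refine (forall_plucker_eq_zero_iff hli k).mpr ?_ I hI
  have hsnd : (fun i => (φ i).2) = fun i => (frame U i).2 := by
    funext i
    simp [hφ, ψ]
  rw [hsnd]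
  exact (forall_plucker_eq_zero_iff (linearIndependent_frame U) k).mp hvan

lemma rankLocus_eq_properTransform [CharZero K] [IsAlgClosed K] {σ : ℚ} {k : ℕ}
    (hσ : σ = k - 1 / 2) (hk : 1 ≤ k) (hu : 0 < u) (huV : u ≤ Module.finrank K V) :
    rankLocus K V W u σ k = properTransform (1 / 2) σ (rankLocus K V W u (1 / 2) k) := by
  refine (rankLocus_subset_properTransform hσ hk huV).antisymm
    (closure_minimal ?_ (isClosed_rankLocus hσ le_rfl hu))
  rintro _ ⟨U, hhalf, hU, hmem, rfl⟩
  exact ⟨U, hU, forall_plucker_eq_zero_of_mem_closure (n := 1) (by norm_num) hk hhalf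
    (subset_closure hmem), rfl⟩

end Density

/-! ### Secant planes of the relative Segre embedding -/

section Secant

lemma map_snd_graph {K V W : Type*} [Field K] [AddCommGroup V] [Module K V] [AddCommGroup W]
    [Module K W] (S : Submodule K V) (f : S →ₗ[K] W) :
    (graph S f).map (LinearMap.snd K V W) = LinearMap.range f := by
  rw [graph, ← LinearMap.range_comp, LinearMap.snd_prod]

variable {K : Type*} {V : Type*} {W : Type*} [Field K]
  [AddCommGroup V] [Module K V] [FiniteDimensional K V]
  [AddCommGroup W] [Module K W] [FiniteDimensional K W] {u : ℕ}

/-- A subspace that projects injectively to `V` is a graph. -/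
lemma exists_eq_graph {U : Gr K V W u} (hU : LinearIndependent K fun i => (frame U i).1) :
    ∃ (S : Submodule K V) (f : S →ₗ[K] W), Module.finrank K S = u ∧ U.1 = graph S f := by
  have hinj : Function.Injective ((LinearMap.fst K V W).domRestrict U.1) := by
    rw [← LinearMap.ker_eq_bot, LinearMap.ker_eq_bot']
    intro x hx
    set b := Module.finBasisOfFinrankEq K U.1 U.2 with hb
    have h1 : ∑ i, b.repr x i • (frame U i).1 = 0 := by
      rw [← hx]
      conv_rhs => rw [← b.sum_repr x]
      rw [map_sum]
      simp only [map_smul]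
      rfl
    have h2 := Fintype.linearIndependent_iff.mp hU _ h1
    exact b.repr.map_eq_zero_iff.mp (Finsupp.ext h2)
  let g := LinearEquiv.ofInjective _ hinj
  refine ⟨_, ((LinearMap.snd K V W).domRestrict U.1) ∘ₗ g.symm.toLinearMap, ?_, ?_⟩
  · rw [← LinearEquiv.finrank_eq g, U.2]
  · ext x
    simp only [graph, LinearMap.mem_range]
    constructor
    · intro hx
      exact ⟨g ⟨x, hx⟩, by ext <;> simp [g]⟩
    · rintro ⟨y, rfl⟩
      obtain ⟨z, rfl⟩ := g.surjective y
      have : ((Submodule.subtype _).prod ((LinearMap.snd K V W).domRestrict U.1 ∘ₗ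
          g.symm.toLinearMap)) (g z) = z.1 := by ext <;> simp [g]
      rw [this]
      exact z.2

lemma Sec_eq_rankLocus [CharZero K] (k : ℕ) : Sec K V W u k = rankLocus K V W u (1 / 2) k := by
  ext y
  constructor
  · rintro ⟨S, f, ⟨-, -, U, hU, hgr, rfl⟩, hrank⟩
    refine ⟨U, hU, (forall_plucker_frame_eq_zero_iff U k).mpr ?_, rfl⟩
    rwa [hgr, map_snd_graph]
  · rintro ⟨U, hU, hvan, rfl⟩
    obtain ⟨⟨I, hI, hI0⟩, J, hJ, hJ0⟩ := (isSemistable_iff (n := 1) (by norm_num) U).mp hU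
    obtain ⟨S, f, hS, hgr⟩ := exists_eq_graph
      (linearIndependent_fst_of_plucker_ne_zero (Nat.lt_one_iff.mp hI) hI0)
    refine ⟨S, f, ⟨hS, ?_, U, hU, hgr, rfl⟩, ?_⟩
    · rintro rfl
      refine hJ0 ((forall_plucker_frame_eq_zero_iff U 0).mpr ?_ J hJ)
      rw [hgr, map_snd_graph, LinearMap.range_zero, finrank_bot]
    · rw [← map_snd_graph, ← hgr]
      exact (forall_plucker_frame_eq_zero_iff U k).mp hvan

lemma exists_linearIndependent_le_span {R : Submodule K W} {k : ℕ} (hR : Module.finrank K R ≤ k)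
    (hk : k ≤ Module.finrank K W) :
    ∃ w : Fin k → W, LinearIndependent K w ∧ R ≤ Submodule.span K (Set.range w) := by
  obtain ⟨R', hRR', hcard⟩ : ∃ R' : Submodule K W, R ≤ R' ∧ Module.finrank K R' = k := by
    induction k, hR using Nat.le_induction with
    | base => exact ⟨R, le_rfl, rfl⟩
    | succ n hn ih =>
      obtain ⟨R', hRR', hcard⟩ := ih (by omega)
      obtain ⟨x, hx⟩ : ∃ x, x ∉ R' := by
        by_contra! h
        have : R' = ⊤ := eq_top_iff.mpr fun x _ => h x
        rw [this, finrank_top] at hcard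
        omega
      refine ⟨R' ⊔ Submodule.span K {x}, hRR'.trans le_sup_left, ?_⟩
      rw [Submodule.finrank_sup_span_singleton hx, hcard]
  let b := Module.finBasisOfFinrankEq K R' hcard
  refine ⟨fun i => b i, b.linearIndependent.map' R'.subtype (Submodule.ker_subtype _), ?_⟩
  have h := congrArg (Submodule.map R'.subtype) b.span_eq
  rw [Submodule.map_span, ← Set.range_comp, Submodule.map_top, Submodule.range_subtype] at h
  exact hRR'.trans h.ge

/-- A nonzero map of rank at most `k` is a combination of `k` linearly independent maps of rank
one. The factors in `W` are completed to `k` linearly independent vectors, and vanishing factors in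
the dual space are replaced by an arbitrary nonzero functional. -/
lemma exists_mem_span_smulRight {E : Type*} [AddCommGroup E] [Module K E] {f : E →ₗ[K] W}
    (hf : f ≠ 0) {k : ℕ} (hrank : Module.finrank K (LinearMap.range f) ≤ k)
    (hk : k ≤ Module.finrank K W) :
    ∃ (ξ : Fin k → Module.Dual K E) (w : Fin k → W),
      LinearIndependent K (fun i => (ξ i).smulRight (w i)) ∧
      f ∈ Submodule.span K (Set.range fun i => (ξ i).smulRight (w i)) := by
  classical
  obtain ⟨w, hw, hle⟩ := exists_linearIndependent_le_span hrank hk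
  have hrep : ∀ x, ∃ c : Fin k → K, ∑ i, c i • w i = f x := fun x =>
    (Submodule.mem_span_range_iff_exists_fun K).mp (hle (LinearMap.mem_range_self f x))
  obtain ⟨g, hg⟩ := (Fintype.linearCombination K w).exists_leftInverse_of_injective
    (LinearMap.ker_eq_bot.mpr hw.fintypeLinearCombination_injective)
  -- The coefficients of `f` with respect to `w`.
  let η : Fin k → Module.Dual K E := fun i => LinearMap.proj i ∘ₗ g ∘ₗ f
  have hη : ∀ x, f x = ∑ i, η i x • w i := by
    intro x
    obtain ⟨c, hc⟩ := hrep x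
    have : g (f x) = c := by
      rw [← hc]
      exact LinearMap.congr_fun hg c
    rw [← hc]
    simp [η, this, hc]
  obtain ⟨i₀, hi₀⟩ : ∃ i, η i ≠ 0 := by
    by_contra! h
    exact hf (LinearMap.ext fun x => by rw [hη]; simp [h])
  let ξ : Fin k → Module.Dual K E := fun i => if η i = 0 then η i₀ else η i
  have hξ : ∀ i, ξ i ≠ 0 := fun i => by
    by_cases h : η i = 0
    · simp [ξ, h, hi₀]
    · simp [ξ, h]
  refine ⟨ξ, w, ?_, ?_⟩
  · rw [Fintype.linearIndependent_iff]
    intro c hc i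
    obtain ⟨x, hx⟩ := DFunLike.ne_iff.mp (hξ i)
    have h1 := LinearMap.congr_fun hc x
    simp only [LinearMap.sum_apply, LinearMap.smul_apply, LinearMap.smulRight_apply, smul_smul,
      LinearMap.zero_apply] at h1
    exact (mul_eq_zero.mp (Fintype.linearIndependent_iff.mp hw _ h1 i)).resolve_right hx
  · have : f = ∑ i, (if η i = 0 then (0 : K) else 1) • (ξ i).smulRight (w i) := by
      ext x
      rw [hη x, LinearMap.sum_apply]
      refine Finset.sum_congr rfl fun i _ => ?_
      by_cases h : η i = 0 <;> simp [ξ, h]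
    rw [this]
    exact Submodule.sum_mem _ fun i _ =>
      Submodule.smul_mem _ _ (Submodule.subset_span (Set.mem_range_self i))

lemma finrank_range_le_of_mem_span {E : Type*} [AddCommGroup E] [Module K E] {f : E →ₗ[K] W}
    {k : ℕ} {ξ : Fin k → Module.Dual K E} {w : Fin k → W}
    (hf : f ∈ Submodule.span K (Set.range fun i => (ξ i).smulRight (w i))) :
    Module.finrank K (LinearMap.range f) ≤ k := by
  obtain ⟨c, rfl⟩ := (Submodule.mem_span_range_iff_exists_fun K).mp hf
  have hle : LinearMap.range (∑ i, c i • (ξ i).smulRight (w i))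
      ≤ Submodule.span K (Set.range w) := by
    rintro _ ⟨x, rfl⟩
    rw [LinearMap.sum_apply]
    refine Submodule.sum_mem _ fun i _ => ?_
    rw [LinearMap.smul_apply, LinearMap.smulRight_apply]
    exact Submodule.smul_mem _ _ (Submodule.smul_mem _ _ (Submodule.subset_span ⟨i, rfl⟩))
  refine (Submodule.finrank_mono hle).trans ((finrank_range_le_card w).trans ?_)
  rw [Fintype.card_fin]

lemma Sec_eq_secantVariety [CharZero K] [IsAlgClosed K] {k : ℕ} (hk : 1 ≤ k) (hu : 0 < u)
    (hkW : k ≤ Module.finrank K W) : Sec K V W u k = secantVariety K V W u k := by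
  have hclosed : IsClosed (Sec K V W u k) := by
    rw [Sec_eq_rankLocus]
    exact isClosed_rankLocus (n := 1) (by norm_num) hk hu
  refine Set.Subset.antisymm (fun y hy => subset_closure ?_) (closure_minimal ?_ hclosed)
  · obtain ⟨S, f, hy, hrank⟩ := hy
    exact ⟨S, f, hy, exists_mem_span_smulRight hy.2.1 hrank hkW⟩
  · rintro y ⟨S, f, hy, ξ, w, -, hf⟩
    exact ⟨S, f, hy, finrank_range_le_of_mem_span hf⟩

end Secant

end CompleteCollineations

end

theorem mainTheorem6 {K V W : Type*} [Field K] [IsAlgClosed K] [CharZero K]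
    [AddCommGroup V] [Module K V] [FiniteDimensional K V]
    [AddCommGroup W] [Module K W] [FiniteDimensional K W]
    (u k : ℕ) (huV : u ≤ Module.finrank K V) (huW : u ≤ Module.finrank K W)
    (hk1 : 1 ≤ k) (hku : k + 1 ≤ u) :
    CompleteCollineations.Zminus K V W u k =
        CompleteCollineations.properTransform (1 / 2) (k - 1 / 2)
          (CompleteCollineations.Sec K V W u k) ∧
      CompleteCollineations.Sec K V W u k = CompleteCollineations.secantVariety K V W u k := by
  refine ⟨?_, CompleteCollineations.Sec_eq_secantVariety hk1 (by omega) (by omega)⟩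
  rw [CompleteCollineations.Zminus_eq_rankLocus, CompleteCollineations.Sec_eq_rankLocus]
  exact CompleteCollineations.rankLocus_eq_properTransform rfl hk1 (by omega) huV
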